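/- Let $G\subset\mathbb R^3$ be open and bounded with $C^\infty$ boundary ($\overline G$ is a $C^\infty$ submanifold with boundary) and strictly convex closure, let $\nu$ be the outward unit normal on $\partial G$, $S\subset\mathbb R^3$ the unit sphere with surface measure $d\omega$, $I=[E_0,E_m]$ with $0\le E_0<E_m<\infty$, and $$\Gamma_-=\{(y,\omega,E)\in\partial G\times S\times I:\omega\cdot\nu(y)<0\},\qquad \Gamma_0=\{(y,\omega,E)\in\partial G\times S\times I:\omega\cdot\nu(y)=0\}.$$ All functions are real valued and $L^p(G\times S\times I)$ is taken with respect to $dx\,d\omega\,dE$. For $k\in\mathbb N_0\cup\{\infty\}$ let $C^{(k,0,0)}(\overline G\times S\times I)$ be the set of restrictions to $G\times S\times I^\circ$ of compactly supported functions $f$ on $\mathbb R^3\times S\times\mathbb R$ all of whose partial derivatives $\partial_x^\alpha f$, $|\alpha|\le k$, exist and are continuous on $\mathbb R^3\times S\times\mathbb R$, and let $$\mathcal D:=\bigcap_{k=1}^\infty\{\psi\in C^{(k,0,0)}(\overline G\times S\times I):\operatorname{supp}\psi\cap(\Gamma_-\cup\Gamma_0)=\emptyset\}.$$ Let $m\in\mathbb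 N_0$. Let $H_0^m:=H_0^{(m,0,0)}(G\times S\times I,\Gamma_-)$ be the completion of $\mathcal D$ with respect to the inner product $\langle\psi,v\rangle=\sum_{|\alpha|\le m}\langle\partial_x^\alpha\psi,\partial_x^\alpha v\rangle_{L^2(G\times S\times I)}$, and let $\mathcal W^m:=\mathcal W^{\infty,(m,0,0)}(G\times S\times I)$ be the completion of $C^{(\infty,0,0)}(\overline G\times S\times I)$ with respect to the norm $\|\phi\|_{W^{\infty,(m,0,0)}}=\max_{|\alpha|\le m}\|\partial_x^\alpha\phi\|_{L^\infty(G\times S\times I)}$. There is a constant $c(m)>0$ depending only on $m$ (not on $G$, $I$) such that $$\|\Sigma\psi\|_{H_0^m}\le c(m)\,\|\Sigma\|_{W^{\infty,(m,0,0)}}\,\|\psi\|_{H_0^m}\qquad\text{for all }\Sigma\in\mathcal W^m,\ \psi\in\mathcal D,\tag{1}$$ where, for $\Sigma\in\mathcal W^m$ and $\psi\in\mathcal D$, the product $\Sigma\psi$ belongs to $H_0^m$. Let $\Sigma\in\mathcal W^m$. The operator $P_m$ in $H_0^m$ with domain $D(P_m)=\mathcal D$ and $P_m\psi=\omega\cdot\nabla_x\psi+\Sigma\psi$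 is well defined (it takes values in $H_0^m$) and closable; let $\widetilde P_m$ be its closure (smallest closed extension). Let $c(m)>0$ be any constant for which (1) holds, and put $C':=c(m)\|\Sigma\|_{W^{\infty,(m,0,0)}}$. Then for every $C\ge C'$ $$\langle(\widetilde P_m+C\,\mathrm{Id})\psi,\psi\rangle_{H_0^m}\ \ge\ (C-C')\,\|\psi\|_{H_0^m}^2\qquad\text{for all }\psi\in D(\widetilde P_m).$$ In particular, for every $C\ge C'$ the operator $\widetilde P_m+C\,\mathrm{Id}$ is accretive in $H_0^m$, i.e. $\langle(\widetilde P_m+C\,\mathrm{Id})\psi,\psi\rangle_{H_0^m}\ge0$ for all $\psi\in D(\widetilde P_m)$. -/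

import Mathlib

open MeasureTheory Set
open scoped ENNReal ContDiff

namespace Transport

/-- Three-dimensional Euclidean space. -/
abbrev E3 : Type := EuclideanSpace ℝ (Fin 3)

/-- The unit sphere `S` of `ℝ³`. -/
abbrev S2 : Type := Metric.sphere (0 : E3) 1

/-- The ambient space `ℝ³ × S × ℝ` of points `(x, ω, E)`. -/
abbrev Pt : Type := E3 × S2 × ℝ

/-- Multi-indices `α ∈ ℕ₀³` with `|α| ≤ m`. -/
abbrev MultiIndex (m : ℕ) : Type := {α : Fin 3 → Fin (m + 1) // ∑ i, (α i : ℕ) ≤ m}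

/-- The underlying element of `ℕ₀³`. -/
def MultiIndex.exps {m : ℕ} (α : MultiIndex m) : Fin 3 → ℕ := fun i => (α.1 i : ℕ)

/-- The multi-index `(0, 0, 0)`. -/
def MultiIndex.zero (m : ℕ) : MultiIndex m := ⟨fun _ => 0, by simp⟩

/-- The list of directions `e₀, …, e₀, e₁, …, e₁, e₂, …, e₂`, where `eᵢ` occurs `aᵢ` times. -/
noncomputable def multiDir (a : Fin 3 → ℕ) (j : Fin (∑ i, a i)) : E3 :=
  EuclideanSpace.single
    (if (j : ℕ) < a 0 then (0 : Fin 3) else if (j : ℕ) < a 0 + a 1 then 1 else 2) (1 : ℝ)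

/-- The partial derivative `∂ₓ^a f` at the point `(x, ω, E)`, taken in the variable `x` only. -/
noncomputable def spatialDeriv (a : Fin 3 → ℕ) (f : Pt → ℝ) (p : Pt) : ℝ :=
  iteratedFDeriv ℝ (∑ i, a i) (fun x => f (x, p.2)) p.1 (multiDir a)

/-- The streaming term `ω · ∇ₓ f` at the point `(x, ω, E)`. -/
noncomputable def streaming (f : Pt → ℝ) (p : Pt) : ℝ :=
  fderiv ℝ (fun x => f (x, p.2)) p.1 (p.2.1 : E3)

/-- The space `C₀^{(k,0,0)}(ℝ³ × S × ℝ)`, `k ∈ ℕ₀ ∪ {∞}`: compactly supported functions all of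
whose partial derivatives in `x` up to order `k` exist and are jointly continuous in
`(x, ω, E)`. -/
structure IsCk0 (k : ℕ∞) (f : Pt → ℝ) : Prop where
  contDiff : ∀ q : S2 × ℝ, ContDiff ℝ (k : WithTop ℕ∞) (fun x => f (x, q))
  continuous : ∀ a : Fin 3 → ℕ, ((∑ i, a i : ℕ) : ℕ∞) ≤ k → Continuous (spatialDeriv a f)
  hasCompactSupport : HasCompactSupport f

/-- `φ` is a smooth function, defined near `y`, without critical points, and such that near `y`
the set `G` is `{φ < 0}`.  (For a boundary point `y` of an open set `G` this means that near `y`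
the closure of `G` is the smooth manifold with boundary `{φ ≤ 0}`, with interior `G`.) -/
def IsDefiningFunction (G : Set E3) (y : E3) (φ : E3 → ℝ) : Prop :=
  ∃ U : Set E3, IsOpen U ∧ y ∈ U ∧ ContDiffOn ℝ ∞ φ U ∧
    (∀ x ∈ U, gradient φ x ≠ 0) ∧ ∀ x ∈ U, (x ∈ G ↔ φ x < 0)

/-- `n` is the outward pointing unit normal of `∂G` at `y`. -/
def IsOutwardUnitNormal (G : Set E3) (y n : E3) : Prop :=
  ∃ φ : E3 → ℝ, IsDefiningFunction G y φ ∧ n = ‖gradient φ y‖⁻¹ • gradient φ y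

/-- The standing geometric data: an open bounded set `G ⊆ ℝ³` with smooth boundary and strictly
convex closure, and an energy interval `I = [E₀, E₁]` with `0 ≤ E₀ < E₁ < ∞`. -/
structure Domain where
  G : Set E3
  E₀ : ℝ
  E₁ : ℝ
  isOpen : IsOpen G
  isBounded : Bornology.IsBounded G
  smooth_boundary : ∀ y ∈ frontier G, ∃ φ : E3 → ℝ, IsDefiningFunction G y φ
  strictConvex_closure : StrictConvex ℝ (closure G)
  E₀_nonneg : 0 ≤ E₀
  E₀_lt_E₁ : E₀ < E₁

namespace Domain

variable (D : Domain)

/-- The set `G × S × I°`. -/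
def Ω : Set Pt := D.G ×ˢ ((univ : Set S2) ×ˢ Ioo D.E₀ D.E₁)

/-- The measure `dx dω dE` on `G × S × I`, `dω` being the surface measure of the unit sphere
(the end points of `I` form a null set). -/
noncomputable def μ : Measure Pt :=
  ((volume : Measure E3).prod
    (((volume : Measure E3).toSphere).prod (volume : Measure ℝ))).restrict D.Ω

/-- The inflow boundary `Γ₋`. -/
def Γminus : Set Pt :=
  {p | p.1 ∈ frontier D.G ∧ p.2.2 ∈ Icc D.E₀ D.E₁ ∧
    ∃ n, IsOutwardUnitNormal D.G p.1 n ∧ inner ℝ (p.2.1 : E3) n < 0}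

/-- The characteristic boundary `Γ₀`. -/
def Γzero : Set Pt :=
  {p | p.1 ∈ frontier D.G ∧ p.2.2 ∈ Icc D.E₀ D.E₁ ∧
    ∃ n, IsOutwardUnitNormal D.G p.1 n ∧ inner ℝ (p.2.1 : E3) n = 0}

/-- The space `C^{(k,0,0)}(Ḡ × S × I)` of restrictions to `G × S × I°` of elements of
`C₀^{(k,0,0)}(ℝ³ × S × ℝ)`.  A function on `G × S × I°` is represented by any function on the
ambient space that agrees with it there. -/
def IsCkBar (k : ℕ∞) (ψ : Pt → ℝ) : Prop :=
  ∃ f : Pt → ℝ, IsCk0 k f ∧ EqOn ψ f D.Ω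

/-- The support of a function on `G × S × I°`, as a closed subset of `Ḡ × S × I`. -/
def supp (ψ : Pt → ℝ) : Set Pt := closure (D.Ω ∩ Function.support ψ)

/-- The space `C₀^{(k,0,0)}(Ḡ × S × I, Γ₋)`. -/
def IsCk0Inflow (k : ℕ∞) (ψ : Pt → ℝ) : Prop :=
  D.IsCkBar k ψ ∧ D.supp ψ ∩ (D.Γminus ∪ D.Γzero) = ∅

end Domain

/-! ### Elementary facts needed to define the function spaces -/

theorem IsCk0.zero (k : ℕ∞) : IsCk0 k (0 : Pt → ℝ) where
  contDiff q := contDiff_const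
  continuous a _ := by
    have : spatialDeriv a (0 : Pt → ℝ) = 0 := by
      funext p
      simp only [spatialDeriv, Pi.zero_apply]
      have := iteratedFDeriv_fun_zero (𝕜 := ℝ) (E := E3) (F := ℝ) (n := ∑ i, a i)
      simp [this]
    rw [this]
    exact continuous_const
  hasCompactSupport := HasCompactSupport.zero

theorem IsCk0.spatialDeriv_add {k : ℕ∞} {f g : Pt → ℝ} (hf : IsCk0 k f) (hg : IsCk0 k g)
    {a : Fin 3 → ℕ} (ha : ((∑ i, a i : ℕ) : ℕ∞) ≤ k) :
    spatialDeriv a (f + g) = spatialDeriv a f + spatialDeriv a g := by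
  funext p
  have h : ((∑ i, a i : ℕ) : WithTop ℕ∞) ≤ (k : WithTop ℕ∞) := by exact_mod_cast ha
  have := iteratedFDeriv_add_apply (x := p.1) ((hf.contDiff p.2).of_le h).contDiffAt
    ((hg.contDiff p.2).of_le h).contDiffAt
  have h2 := congrArg (fun M => M (multiDir a)) this
  exact h2

theorem IsCk0.spatialDeriv_smul {k : ℕ∞} {f : Pt → ℝ} (hf : IsCk0 k f) (c : ℝ)
    {a : Fin 3 → ℕ} (ha : ((∑ i, a i : ℕ) : ℕ∞) ≤ k) :
    spatialDeriv a (c • f) = c • spatialDeriv a f := by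
  funext p
  have h : ((∑ i, a i : ℕ) : WithTop ℕ∞) ≤ (k : WithTop ℕ∞) := by exact_mod_cast ha
  have := iteratedFDeriv_const_smul_apply (x := p.1) (a := c)
    ((hf.contDiff p.2).of_le h).contDiffAt
  have h2 := congrArg (fun M => M (multiDir a)) this
  exact h2

theorem IsCk0.add {k : ℕ∞} {f g : Pt → ℝ} (hf : IsCk0 k f) (hg : IsCk0 k g) :
    IsCk0 k (f + g) where
  contDiff q := (hf.contDiff q).add (hg.contDiff q)
  continuous a ha := by
    rw [hf.spatialDeriv_add hg ha]
    exact (hf.continuous a ha).add (hg.continuous a ha)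
  hasCompactSupport := hf.hasCompactSupport.add hg.hasCompactSupport

theorem IsCk0.smul {k : ℕ∞} {f : Pt → ℝ} (hf : IsCk0 k f) (c : ℝ) : IsCk0 k (c • f) where
  contDiff q := contDiff_const.smul (hf.contDiff q)
  continuous a ha := by
    rw [hf.spatialDeriv_smul c ha]
    exact (hf.continuous a ha).const_smul c
  hasCompactSupport := hf.hasCompactSupport.mono (Function.support_const_smul_subset c f)

theorem IsCk0.hasCompactSupport_spatialDeriv {k : ℕ∞} {f : Pt → ℝ} (hf : IsCk0 k f)
    (a : Fin 3 → ℕ) : HasCompactSupport (spatialDeriv a f) := by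
  refine hf.hasCompactSupport.mono' fun p hp => ?_
  by_contra hn
  refine hp ?_
  have h0 : f =ᶠ[nhds p] 0 := notMem_tsupport_iff_eventuallyEq.mp hn
  have hc : Filter.Tendsto (fun x : E3 => ((x, p.2) : Pt)) (nhds p.1) (nhds p) :=
    (Continuous.prodMk_left p.2).tendsto p.1
  have h1 : (fun x : E3 => f (x, p.2)) =ᶠ[nhds p.1] fun _ => 0 := hc.eventually h0
  have h2 := (h1.iteratedFDeriv ℝ (∑ i, a i)).eq_of_nhds
  have h3 := iteratedFDeriv_fun_zero (𝕜 := ℝ) (E := E3) (F := ℝ) (n := ∑ i, a i)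
  simp only [spatialDeriv, h2]
  simp [h3]

theorem toLp_add_of_ae {μ : Measure Pt} {r : ℝ≥0∞} {f g h : Pt → ℝ} (hf : MemLp f r μ)
    (hg : MemLp g r μ) (hh : MemLp h r μ) (e : h =ᵐ[μ] f + g) :
    hh.toLp h = hf.toLp f + hg.toLp g := by
  rw [← MemLp.toLp_add hf hg]
  exact (MemLp.toLp_eq_toLp_iff hh (hf.add hg)).mpr e

theorem toLp_smul_of_ae {μ : Measure Pt} {r : ℝ≥0∞} {f h : Pt → ℝ} (hf : MemLp f r μ)
    (hh : MemLp h r μ) (c : ℝ) (e : h =ᵐ[μ] c • f) : hh.toLp h = c • hf.toLp f := by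
  rw [← MemLp.toLp_const_smul c hf]
  exact (MemLp.toLp_eq_toLp_iff hh (hf.const_smul c)).mpr e

namespace Domain

variable {D : Domain}

theorem mem_nhds_slice {p : Pt} (hp : p ∈ D.Ω) : ∀ᶠ x in nhds p.1, ((x, p.2) : Pt) ∈ D.Ω :=
  Filter.Eventually.mono (D.isOpen.mem_nhds hp.1) fun _ hx => ⟨hx, hp.2⟩

theorem spatialDeriv_congr {f g : Pt → ℝ} (h : EqOn f g D.Ω) (a : Fin 3 → ℕ) :
    EqOn (spatialDeriv a f) (spatialDeriv a g) D.Ω := by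
  intro p hp
  have h1 : (fun x : E3 => f (x, p.2)) =ᶠ[nhds p.1] fun x => g (x, p.2) :=
    (mem_nhds_slice hp).mono fun x hx => h hx
  simp only [spatialDeriv, (h1.iteratedFDeriv ℝ (∑ i, a i)).eq_of_nhds]

theorem streaming_congr {f g : Pt → ℝ} (h : EqOn f g D.Ω) :
    EqOn (streaming f) (streaming g) D.Ω := by
  intro p hp
  have h1 : (fun x : E3 => f (x, p.2)) =ᶠ[nhds p.1] fun x => g (x, p.2) :=
    (mem_nhds_slice hp).mono fun x hx => h hx
  simp only [streaming, h1.fderiv_eq]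

theorem measurableSet_Ω : MeasurableSet D.Ω :=
  D.isOpen.measurableSet.prod (MeasurableSet.univ.prod measurableSet_Ioo)

theorem ae_eq_of_eqOn {f g : Pt → ℝ} (h : EqOn f g D.Ω) : f =ᵐ[D.μ] g :=
  (ae_restrict_mem measurableSet_Ω).mono fun _ hp => h hp

theorem IsCkBar.add {k : ℕ∞} {ψ φ : Pt → ℝ} (h : D.IsCkBar k ψ) (h' : D.IsCkBar k φ) :
    D.IsCkBar k (ψ + φ) := by
  obtain ⟨f, hf, hψ⟩ := h
  obtain ⟨g, hg, hφ⟩ := h'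
  exact ⟨f + g, hf.add hg, fun p hp => by simp [hψ hp, hφ hp]⟩

theorem IsCkBar.smul {k : ℕ∞} {ψ : Pt → ℝ} (h : D.IsCkBar k ψ) (c : ℝ) :
    D.IsCkBar k (c • ψ) := by
  obtain ⟨f, hf, hψ⟩ := h
  exact ⟨c • f, hf.smul c, fun p hp => by simp [hψ hp]⟩

theorem IsCkBar.zero (k : ℕ∞) : D.IsCkBar k 0 := ⟨0, IsCk0.zero k, fun _ _ => rfl⟩

theorem IsCkBar.spatialDeriv_add {k : ℕ∞} {ψ φ : Pt → ℝ} (h : D.IsCkBar k ψ)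
    (h' : D.IsCkBar k φ) {a : Fin 3 → ℕ} (ha : ((∑ i, a i : ℕ) : ℕ∞) ≤ k) :
    spatialDeriv a (ψ + φ) =ᵐ[D.μ] spatialDeriv a ψ + spatialDeriv a φ := by
  obtain ⟨f, hf, hψ⟩ := h
  obtain ⟨g, hg, hφ⟩ := h'
  refine ae_eq_of_eqOn fun p hp => ?_
  have h1 : EqOn (ψ + φ) (f + g) D.Ω := fun p hp => by simp [hψ hp, hφ hp]
  rw [spatialDeriv_congr h1 a hp, hf.spatialDeriv_add hg ha, Pi.add_apply, Pi.add_apply,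
    spatialDeriv_congr hψ a hp, spatialDeriv_congr hφ a hp]

theorem IsCkBar.spatialDeriv_smul {k : ℕ∞} {ψ : Pt → ℝ} (h : D.IsCkBar k ψ) (c : ℝ)
    {a : Fin 3 → ℕ} (ha : ((∑ i, a i : ℕ) : ℕ∞) ≤ k) :
    spatialDeriv a (c • ψ) =ᵐ[D.μ] c • spatialDeriv a ψ := by
  obtain ⟨f, hf, hψ⟩ := h
  refine ae_eq_of_eqOn fun p hp => ?_
  have h1 : EqOn (c • ψ) (c • f) D.Ω := fun p hp => by simp [hψ hp]
  rw [spatialDeriv_congr h1 a hp, hf.spatialDeriv_smul c ha, Pi.smul_apply, Pi.smul_apply,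
    spatialDeriv_congr hψ a hp]

theorem IsCkBar.memLp {k : ℕ∞} {ψ : Pt → ℝ} (h : D.IsCkBar k ψ) (r : ℝ≥0∞)
    {a : Fin 3 → ℕ} (ha : ((∑ i, a i : ℕ) : ℕ∞) ≤ k) : MemLp (spatialDeriv a ψ) r D.μ := by
  obtain ⟨f, hf, hψ⟩ := h
  have h1 := ((hf.continuous a ha).memLp_of_hasCompactSupport (p := r)
    (μ := (volume : Measure E3).prod
      (((volume : Measure E3).toSphere).prod (volume : Measure ℝ)))
    (hf.hasCompactSupport_spatialDeriv a)).restrict D.Ω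
  exact (memLp_congr_ae (ae_eq_of_eqOn (spatialDeriv_congr hψ a))).mpr h1

theorem IsCkBar.streaming_add {k : ℕ∞} (hk : 1 ≤ k) {ψ φ : Pt → ℝ} (h : D.IsCkBar k ψ)
    (h' : D.IsCkBar k φ) : streaming (ψ + φ) =ᵐ[D.μ] streaming ψ + streaming φ := by
  obtain ⟨f, hf, hψ⟩ := h
  obtain ⟨g, hg, hφ⟩ := h'
  refine ae_eq_of_eqOn fun p hp => ?_
  have h1 : EqOn (ψ + φ) (f + g) D.Ω := fun p hp => by simp [hψ hp, hφ hp]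
  have hk' : (k : WithTop ℕ∞) ≠ 0 := by
    have : k ≠ 0 := (zero_lt_one.trans_le hk).ne'
    exact_mod_cast this
  rw [streaming_congr h1 hp, Pi.add_apply, streaming_congr hψ hp, streaming_congr hφ hp]
  have := fderiv_add (((hf.contDiff p.2).differentiable hk') p.1)
    (((hg.contDiff p.2).differentiable hk') p.1)
  exact congrArg (fun M => M (p.2.1 : E3)) this

theorem IsCkBar.streaming_smul {k : ℕ∞} (hk : 1 ≤ k) {ψ : Pt → ℝ} (h : D.IsCkBar k ψ) (c : ℝ) :
    streaming (c • ψ) =ᵐ[D.μ] c • streaming ψ := by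
  obtain ⟨f, hf, hψ⟩ := h
  refine ae_eq_of_eqOn fun p hp => ?_
  have h1 : EqOn (c • ψ) (c • f) D.Ω := fun p hp => by simp [hψ hp]
  have hk' : (k : WithTop ℕ∞) ≠ 0 := by
    have : k ≠ 0 := (zero_lt_one.trans_le hk).ne'
    exact_mod_cast this
  rw [streaming_congr h1 hp, Pi.smul_apply, streaming_congr hψ hp]
  have := fderiv_const_smul (((hf.contDiff p.2).differentiable hk') p.1) c
  exact congrArg (fun M => M (p.2.1 : E3)) this

variable (D)

/-! ### Function spaces -/

/-- The space `⋂_{k ≥ 1} C₀^{(k,0,0)}(Ḡ × S × I, Γ₋)`. -/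
def testSpace : Submodule ℝ (Pt → ℝ) where
  carrier := {ψ | ∀ k : ℕ, 1 ≤ k → D.IsCk0Inflow k ψ}
  zero_mem' := fun k _ => ⟨IsCkBar.zero k, by simp [supp]⟩
  add_mem' := by
    intro ψ φ hψ hφ k hk
    refine ⟨(hψ k hk).1.add (hφ k hk).1, ?_⟩
    have hsub : D.supp (ψ + φ) ⊆ D.supp ψ ∪ D.supp φ := by
      rw [supp, supp, supp, ← closure_union, ← inter_union_distrib_left]
      exact closure_mono (inter_subset_inter_right _ (Function.support_add ψ φ))
    rw [← subset_empty_iff]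
    refine (inter_subset_inter_left _ hsub).trans ?_
    rw [union_inter_distrib_right, (hψ k hk).2, (hφ k hk).2, union_empty]
  smul_mem' := by
    intro c ψ hψ k hk
    refine ⟨(hψ k hk).1.smul c, ?_⟩
    have hsub : D.supp (c • ψ) ⊆ D.supp ψ :=
      closure_mono (inter_subset_inter_right _ (Function.support_const_smul_subset c ψ))
    rw [← subset_empty_iff, ← (hψ k hk).2]
    exact inter_subset_inter_left _ hsub

/-- The space `C^{(∞,0,0)}(Ḡ × S × I)`. -/
def smoothSpace : Submodule ℝ (Pt → ℝ) where
  carrier := {φ | D.IsCkBar ⊤ φ}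
  zero_mem' := IsCkBar.zero ⊤
  add_mem' := fun h h' => IsCkBar.add h h'
  smul_mem' := fun c _ h => IsCkBar.smul h c

variable {D} in
theorem isCkBar_of_mem_testSpace {ψ : Pt → ℝ} (h : ψ ∈ D.testSpace) (m : ℕ) :
    D.IsCkBar ((m + 1 : ℕ) : ℕ∞) ψ := (h (m + 1) (by omega)).1

theorem _root_.Transport.MultiIndex.sum_exps_le {m : ℕ} (α : MultiIndex m) :
    ((∑ i, α.exps i : ℕ) : ℕ∞) ≤ ((m + 1 : ℕ) : ℕ∞) := by
  have h : ∑ i, α.exps i ≤ m := α.2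
  exact_mod_cast h.trans (Nat.le_succ m)

/-- Families `(u_α)_{|α| ≤ m}` in `L²(G × S × I)` with the inner product
`⟨u, v⟩ = ∑_{|α| ≤ m} ⟨u_α, v_α⟩_{L²}`.  A function `ψ` with spatial derivatives in `L²` is
identified with the family `(∂ₓ^α ψ)_α`; the function itself is the component `α = 0`. -/
abbrev Jet2 (m : ℕ) : Type := PiLp 2 (fun _ : MultiIndex m => Lp ℝ 2 D.μ)

/-- Families `(s_α)_{|α| ≤ m}` in `L^∞(G × S × I)` with the norm `max_{|α| ≤ m} ‖s_α‖_{L^∞}`. -/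
abbrev JetInf (m : ℕ) : Type := MultiIndex m → Lp ℝ ∞ D.μ

/-- The isometric embedding `ψ ↦ (∂ₓ^α ψ)_α` of the test functions with the inner product of
`H^{(m,0,0)}(G × S × I)`. -/
noncomputable def jet2 (m : ℕ) : D.testSpace →ₗ[ℝ] D.Jet2 m where
  toFun ψ := WithLp.toLp 2 fun α =>
    ((isCkBar_of_mem_testSpace ψ.2 m).memLp 2 α.sum_exps_le).toLp (spatialDeriv α.exps ψ)
  map_add' ψ φ := by
    rw [← WithLp.toLp_add]
    congr 1
    funext α
    exact toLp_add_of_ae _ _ _ ((isCkBar_of_mem_testSpace ψ.2 m).spatialDeriv_add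
      (isCkBar_of_mem_testSpace φ.2 m) α.sum_exps_le)
  map_smul' c ψ := by
    rw [RingHom.id_apply, ← WithLp.toLp_smul]
    congr 1
    funext α
    exact toLp_smul_of_ae _ _ c
      ((isCkBar_of_mem_testSpace ψ.2 m).spatialDeriv_smul c α.sum_exps_le)

/-- The embedding `φ ↦ (∂ₓ^α φ)_α` of `C^{(∞,0,0)}(Ḡ × S × I)` with the norm of
`W^{∞,(m,0,0)}(G × S × I)`. -/
noncomputable def jetInf (m : ℕ) : D.smoothSpace →ₗ[ℝ] D.JetInf m where
  toFun φ := fun α => (IsCkBar.memLp φ.2 ∞ le_top).toLp (spatialDeriv α.exps φ)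
  map_add' ψ φ := by
    funext α
    exact toLp_add_of_ae _ _ _ (IsCkBar.spatialDeriv_add ψ.2 φ.2 le_top)
  map_smul' c ψ := by
    funext α
    exact toLp_smul_of_ae _ _ c (IsCkBar.spatialDeriv_smul ψ.2 c le_top)

/-- The Hilbert space `H₀^{(m,0,0)}(G × S × I, Γ₋)`: the completion of the test functions with
respect to the inner product of `H^{(m,0,0)}(G × S × I)`. -/
noncomputable def H0 (m : ℕ) : Submodule ℝ (D.Jet2 m) :=
  (LinearMap.range (D.jet2 m)).topologicalClosure

/-- The space `𝒲^{∞,(m,0,0)}(G × S × I)`: the completion of `C^{(∞,0,0)}(Ḡ × S × I)` with respect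
to the norm of `W^{∞,(m,0,0)}(G × S × I)`. -/
noncomputable def W (m : ℕ) : Submodule ℝ (D.JetInf m) :=
  (LinearMap.range (D.jetInf m)).topologicalClosure

/-- A test function as an element of `H₀^{(m,0,0)}(G × S × I, Γ₋)`. -/
noncomputable def toH0 (m : ℕ) : D.testSpace →ₗ[ℝ] D.H0 m :=
  (D.jet2 m).codRestrict (D.H0 m) fun ψ =>
    Submodule.le_topologicalClosure _ (LinearMap.mem_range_self _ ψ)

variable {D}

/-- The `L²` function underlying an element of `H₀^{(m,0,0)}(G × S × I, Γ₋)`. -/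
noncomputable def H0.fn {m : ℕ} (u : D.H0 m) : Lp ℝ 2 D.μ := (u : D.Jet2 m) (MultiIndex.zero m)

/-- The `L^∞` function underlying an element of `𝒲^{∞,(m,0,0)}(G × S × I)`. -/
noncomputable def W.fn {m : ℕ} (σ : D.W m) : Lp ℝ ∞ D.μ := (σ : D.JetInf m) (MultiIndex.zero m)

/-- `w ∈ H₀^{(m,0,0)}(G × S × I, Γ₋)` is the product `Σ ψ`. -/
def IsProduct {m : ℕ} (σ : D.W m) (ψ : D.testSpace) (w : D.H0 m) : Prop :=
  H0.fn w =ᵐ[D.μ] fun p => W.fn σ p * (ψ : Pt → ℝ) p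

/-- `f ∈ H₀^{(m,0,0)}(G × S × I, Γ₋)` is `P ψ = ω · ∇ₓ ψ + Σ ψ`. -/
def IsTransportImage {m : ℕ} (σ : D.W m) (ψ : D.testSpace) (f : D.H0 m) : Prop :=
  H0.fn f =ᵐ[D.μ] fun p => streaming (ψ : Pt → ℝ) p + W.fn σ p * (ψ : Pt → ℝ) p

variable (D) in
/-- The inequality `‖Σ ψ‖ ≤ c ‖Σ‖ ‖ψ‖` for all `Σ ∈ 𝒲^{∞,(m,0,0)}(G × S × I)` and all test
functions `ψ`. -/
def ProductBound (m : ℕ) (c : ℝ) : Prop :=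
  ∀ (σ : D.W m) (ψ : D.testSpace) (w : D.H0 m), IsProduct σ ψ w →
    ‖w‖ ≤ c * ‖σ‖ * ‖D.toH0 m ψ‖

/-- The graph of `P_m`: all pairs `(ψ, P ψ)` with `ψ` a test function. -/
def transportGraph {m : ℕ} (σ : D.W m) : Submodule ℝ (D.H0 m × D.H0 m) where
  carrier := {z | ∃ ψ : D.testSpace, D.toH0 m ψ = z.1 ∧ IsTransportImage σ ψ z.2}
  zero_mem' := by
    refine ⟨0, map_zero _, ?_⟩
    have h1 : H0.fn (0 : D.H0 m) = 0 := rfl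
    have h2 : streaming (0 : Pt → ℝ) = 0 := by
      funext p
      simp [streaming]
    simp only [IsTransportImage, Prod.snd_zero, h1, Submodule.coe_zero, h2, Pi.zero_apply,
      mul_zero, add_zero]
    exact Lp.coeFn_zero ℝ 2 D.μ
  add_mem' := by
    rintro z z' ⟨ψ, hψ, h⟩ ⟨φ, hφ, h'⟩
    refine ⟨ψ + φ, by rw [map_add, hψ, hφ, Prod.fst_add], ?_⟩
    have h1 : H0.fn (z + z').2 = H0.fn z.2 + H0.fn z'.2 := rfl
    have h2 := IsCkBar.streaming_add (k := ((0 + 1 : ℕ) : ℕ∞)) (by simp)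
      (isCkBar_of_mem_testSpace ψ.2 0) (isCkBar_of_mem_testSpace φ.2 0)
    unfold IsTransportImage at h h' ⊢
    rw [h1]
    filter_upwards [h, h', h2, Lp.coeFn_add (H0.fn z.2) (H0.fn z'.2)] with p e1 e2 e3 e4
    rw [e4, Pi.add_apply, e1, e2, Submodule.coe_add, e3, Pi.add_apply, Pi.add_apply]
    ring
  smul_mem' := by
    rintro c z ⟨ψ, hψ, h⟩
    refine ⟨c • ψ, by rw [map_smul, hψ, Prod.smul_fst], ?_⟩
    have h1 : H0.fn (c • z).2 = c • H0.fn z.2 := rfl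
    have h2 := IsCkBar.streaming_smul (k := ((0 + 1 : ℕ) : ℕ∞)) (by simp)
      (isCkBar_of_mem_testSpace ψ.2 0) c
    unfold IsTransportImage at h ⊢
    rw [h1]
    filter_upwards [h, h2, Lp.coeFn_smul c (H0.fn z.2)] with p e1 e3 e4
    rw [e4, Pi.smul_apply, e1, Submodule.coe_smul, e3, Pi.smul_apply, Pi.smul_apply]
    simp only [smul_eq_mul]
    ring

/-- The unbounded operator `P_m` in `H₀^{(m,0,0)}(G × S × I, Γ₋)`, whose domain consists of the
test functions and which maps `ψ` to `ω · ∇ₓ ψ + Σ ψ`. -/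
noncomputable def transportOp {m : ℕ} (σ : D.W m) : D.H0 m →ₗ.[ℝ] D.H0 m :=
  (transportGraph σ).toLinearPMap

end Domain

/-- An unbounded operator `A` in a real inner product space is accretive if `⟨A u, u⟩ ≥ 0` for all
`u` in its domain. -/
def IsAccretive {H : Type*} [NormedAddCommGroup H] [InnerProductSpace ℝ H]
    (A : H →ₗ.[ℝ] H) : Prop :=
  ∀ u : A.domain, 0 ≤ inner ℝ (A u) (u : H)

end Transport

/-! On a test function, `P_m ψ` is the sum of the streaming term `ω·∇ψ` and the product `Σψ`.
Spatial derivatives commute with `ω·∇`, so the `H₀^m` inner product of `ω·∇ψ` with `ψ` is the sum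
over `α` of `∫ (ω·∇u) u = ½ ∫ ω·∇(u²)` with `u = ∂^α ψ`. Morally this is half the boundary integral
of `u² (ω·ν)`, which is nonnegative because `u` vanishes on the inflow part. The proof
(`setIntegral_fderiv_mul_self_nonneg`) avoids surface integrals: it uses difference quotients of
`1_G u²` along `ω`, whose integrals over `G` are nonnegative by translation invariance, and passes
to the limit by dominated convergence. By Cauchy–Schwarz and the product estimate, the other term is
at least `-c‖Σ‖‖ψ‖²`. Hence `⟨P_m ψ, ψ⟩ ≥ -c‖Σ‖‖ψ‖²` on the graph (`inner_transportGraph_ge`).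

The inequality is a closed condition on pairs, so it persists on the closure of the graph. A linear
relation with such a bound and dense domain is single-valued (`snd_eq_zero_of_quasiaccretive`); this
gives closability, and the estimate for the closure is then the same inequality plus `C‖ψ‖²`.

Two facts make the operator meaningful. Products with `Σ ∈ 𝒲^m` are limits of products with smooth
functions, controlled by the Leibniz rule with a constant that depends on `m` alone
(`norm_toH0_mulTest_le`, `exists_isProduct`). Products and images are specified only through their
underlying `L²` function, so uniqueness needs an element of `H₀^m` to be determined by that
function: its other components are weak derivatives (`H0.fn_injective`). -/

namespace Transport

/-! ### Iterated partial derivatives in the spatial variable -/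

/-- The partial derivative `∂f/∂xᵢ`. -/
noncomputable def xPartial (i : Fin 3) (f : Pt → ℝ) (p : Pt) : ℝ :=
  fderiv ℝ (fun x => f (x, p.2)) p.1 (EuclideanSpace.single i (1 : ℝ))

/-- The iterated spatial partial derivative along a list of coordinate directions; the head of the
list is the direction differentiated first. -/
noncomputable def xPartials : List (Fin 3) → (Pt → ℝ) → Pt → ℝ
  | [], f => f
  | i :: J, f => xPartials J (xPartial i f)

/-- All the slices `x ↦ f (x, ω, E)` are of class `Cⁿ`. -/
def SliceContDiff (n : ℕ) (f : Pt → ℝ) : Prop :=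
  ∀ q : S2 × ℝ, ContDiff ℝ n (fun x => f (x, q))

/-- `f` and all its spatial partial derivatives up to order `k` exist and are jointly continuous. -/
def IsXCk : ℕ → (Pt → ℝ) → Prop
  | 0, f => Continuous f
  | k + 1, f => Continuous f ∧ (∀ q : S2 × ℝ, Differentiable ℝ (fun x => f (x, q))) ∧
      ∀ i, IsXCk k (xPartial i f)

theorem SliceContDiff.of_le {n k : ℕ} {f : Pt → ℝ} (h : SliceContDiff k f) (hn : n ≤ k) :
    SliceContDiff n f := fun q => (h q).of_le (by exact_mod_cast hn)

theorem SliceContDiff.differentiable {n : ℕ} {f : Pt → ℝ} (h : SliceContDiff (n + 1) f)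
    (q : S2 × ℝ) : Differentiable ℝ (fun x => f (x, q)) :=
  (h q).differentiable (by exact_mod_cast Nat.succ_ne_zero n)

theorem SliceContDiff.xPartial {n : ℕ} {f : Pt → ℝ} (h : SliceContDiff (n + 1) f) (i : Fin 3) :
    SliceContDiff n (xPartial i f) := fun q => by
  have h1 : ContDiff ℝ (n + 1) (fun x => f (x, q)) := by exact_mod_cast h q
  exact (contDiff_succ_iff_fderiv_apply.mp h1).2.2 _

theorem xPartials_append (J K : List (Fin 3)) (f : Pt → ℝ) :
    xPartials (J ++ K) f = xPartials K (xPartials J f) := by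
  induction J generalizing f with
  | nil => rfl
  | cons i J ih => exact ih _

/-- Both sides are values of the second derivative of the slice, which is symmetric for `C²`
functions. -/
theorem xPartial_comm {f : Pt → ℝ} (h : SliceContDiff 2 f) (i j : Fin 3) :
    xPartial i (xPartial j f) = xPartial j (xPartial i f) := by
  funext p
  have hs : IsSymmSndFDerivAt ℝ (fun x => f (x, p.2)) p.1 :=
    (h p.2).contDiffAt.isSymmSndFDerivAt (by simp)
  have hd : DifferentiableAt ℝ (fderiv ℝ (fun x => f (x, p.2))) p.1 := by
    have h1 : ContDiff ℝ (1 + 1) (fun x => f (x, p.2)) := by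
      have := h p.2
      norm_num at this ⊢
      exact this
    exact (contDiff_succ_iff_fderiv.mp h1).2.2.differentiable (by norm_num) _
  have key : ∀ k l : Fin 3, xPartial k (xPartial l f) p =
      fderiv ℝ (fderiv ℝ (fun x => f (x, p.2))) p.1 (EuclideanSpace.single k 1)
        (EuclideanSpace.single l 1) := by
    intro k l
    have : (fun x => xPartial l f (x, p.2)) =
      fun x => fderiv ℝ (fun x => f (x, p.2)) x (EuclideanSpace.single l (1 : ℝ)) := rfl
    rw [xPartial, this, fderiv_clm_apply hd (differentiableAt_const _)]
    simp
  rw [key, key, hs.eq]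

theorem xPartials_perm {J K : List (Fin 3)} (hJK : J.Perm K) {f : Pt → ℝ}
    (hf : SliceContDiff J.length f) : xPartials J f = xPartials K f := by
  induction hJK generalizing f with
  | nil => rfl
  | cons i _ ih => exact ih (hf.xPartial i)
  | swap i j J =>
    simp only [xPartials]
    rw [xPartial_comm (hf.of_le (by simp))]
  | trans h1 _ ih1 ih2 => rw [ih1 hf, ih2 (by rwa [← h1.length_eq])]

/-- The list is reversed because the first argument of `iteratedFDeriv` belongs to the outermost
derivative, whereas the head of a list is differentiated first. -/
theorem iteratedFDeriv_slice_eq_xPartials {n : ℕ} {f : Pt → ℝ} (hf : SliceContDiff n f)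
    (v : Fin n → Fin 3) (p : Pt) :
    iteratedFDeriv ℝ n (fun x => f (x, p.2)) p.1 (fun k => EuclideanSpace.single (v k) (1 : ℝ)) =
      xPartials (List.ofFn v).reverse f p := by
  induction n generalizing p with
  | zero => simp [xPartials]
  | succ n ih =>
    have hd : DifferentiableAt ℝ (iteratedFDeriv ℝ n (fun x => f (x, p.2))) p.1 :=
      (hf p.2).differentiable_iteratedFDeriv (by exact_mod_cast Nat.lt_succ_self n) _
    rw [hd.iteratedFDeriv_succ_apply_left', List.ofFn_succ, List.reverse_cons, xPartials_append]
    have := fun x => ih (hf.of_le n.le_succ) (fun k => v k.succ) (x, p.2)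
    simp only at this
    simp only [Fin.tail_def, this]
    rfl

/-- The list `[0, …, 0, 1, …, 1, 2, …, 2]` in which `i` occurs `aᵢ` times. -/
def sortedList (a : Fin 3 → ℕ) : List (Fin 3) :=
  List.replicate (a 0) 0 ++ (List.replicate (a 1) 1 ++ List.replicate (a 2) 2)

theorem length_sortedList (a : Fin 3 → ℕ) : (sortedList a).length = ∑ i, a i := by
  simp [sortedList, Fin.sum_univ_three, add_assoc]

theorem count_sortedList (a : Fin 3 → ℕ) (i : Fin 3) : (sortedList a).count i = a i := by
  fin_cases i <;> simp [sortedList, List.count_replicate]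

theorem perm_sortedList {J : List (Fin 3)} {a : Fin 3 → ℕ} (h : ∀ i, J.count i = a i) :
    J.Perm (sortedList a) :=
  List.perm_iff_count.mpr fun i => by rw [h, count_sortedList]

theorem length_eq_of_count {J : List (Fin 3)} {a : Fin 3 → ℕ} (h : ∀ i, J.count i = a i) :
    J.length = ∑ i, a i := by
  rw [(perm_sortedList h).length_eq, length_sortedList]

theorem spatialDeriv_eq_xPartials_sortedList {a : Fin 3 → ℕ} {f : Pt → ℝ}
    (hf : SliceContDiff (∑ i, a i) f) : spatialDeriv a f = xPartials (sortedList a) f := by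
  funext p
  have h := iteratedFDeriv_slice_eq_xPartials hf (fun j : Fin (∑ i, a i) =>
    if (j : ℕ) < a 0 then (0 : Fin 3) else if (j : ℕ) < a 0 + a 1 then 1 else 2) p
  have hl : List.ofFn (fun j : Fin (∑ i, a i) =>
      if (j : ℕ) < a 0 then (0 : Fin 3) else if (j : ℕ) < a 0 + a 1 then 1 else 2) =
      sortedList a := by
    refine List.ext_getElem (by simp [length_sortedList]) fun n h1 h2 => ?_
    simp only [List.getElem_ofFn, sortedList, List.getElem_append, List.length_replicate,
      List.getElem_replicate]
    split_ifs <;> first | rfl | omega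
  rw [hl] at h
  rw [xPartials_perm (List.reverse_perm (sortedList a)).symm
    (by rwa [length_sortedList]), ← h]
  rfl

/-- The dictionary between multi-indices and lists: order is irrelevant, so only the number of
occurrences of each direction counts. Inductions run on lists, norms on multi-indices. -/
theorem spatialDeriv_eq_xPartials {J : List (Fin 3)} {a : Fin 3 → ℕ} (h : ∀ i, J.count i = a i)
    {f : Pt → ℝ} (hf : SliceContDiff J.length f) : spatialDeriv a f = xPartials J f := by
  rw [spatialDeriv_eq_xPartials_sortedList (by rwa [← length_eq_of_count h]),
    xPartials_perm (perm_sortedList h) hf]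

/-! ### The classes `IsXCk` -/

theorem IsXCk.continuous {k : ℕ} {f : Pt → ℝ} (h : IsXCk k f) : Continuous f := by
  cases k with
  | zero => exact h
  | succ k => exact h.1

theorem IsXCk.of_succ {k : ℕ} {f : Pt → ℝ} (h : IsXCk (k + 1) f) : IsXCk k f := by
  induction k generalizing f with
  | zero => exact h.1
  | succ k ih => exact ⟨h.1, h.2.1, fun i => ih (h.2.2 i)⟩

theorem IsXCk.of_le {n k : ℕ} (hn : n ≤ k) {f : Pt → ℝ} (h : IsXCk k f) : IsXCk n f := by
  induction hn with
  | refl => exact h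
  | step _ ih => exact ih h.of_succ

theorem xPartial_const_in_x (g : S2 × ℝ → ℝ) (i : Fin 3) :
    xPartial i (fun p => g p.2) = fun _ => 0 := by
  funext p
  simp [xPartial]

theorem isXCk_zero (k : ℕ) : IsXCk k (fun _ => 0) := by
  induction k with
  | zero => exact continuous_const
  | succ k ih =>
    refine ⟨continuous_const, fun q => differentiable_const _, fun i => ?_⟩
    rw [xPartial_const_in_x (fun _ => 0)]
    exact ih

/-- Covers the coefficients `ωᵢ` of the streaming operator, which lack the compact support demanded
by `IsCk0`. -/
theorem isXCk_const_in_x (k : ℕ) {g : S2 × ℝ → ℝ} (hg : Continuous g) :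
    IsXCk k (fun p => g p.2) := by
  cases k with
  | zero => exact hg.comp continuous_snd
  | succ k =>
    refine ⟨hg.comp continuous_snd, fun q => differentiable_const (g q), fun i => ?_⟩
    rw [xPartial_const_in_x]
    exact isXCk_zero k

theorem xPartial_add {f g : Pt → ℝ} (hf : ∀ q, Differentiable ℝ (fun x => f (x, q)))
    (hg : ∀ q, Differentiable ℝ (fun x => g (x, q))) (i : Fin 3) :
    xPartial i (f + g) = xPartial i f + xPartial i g := by
  funext p
  have := fderiv_add (hf p.2 p.1) (hg p.2 p.1)
  exact congrArg (fun M => M (EuclideanSpace.single i (1 : ℝ))) this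

theorem xPartial_mul {f g : Pt → ℝ} (hf : ∀ q, Differentiable ℝ (fun x => f (x, q)))
    (hg : ∀ q, Differentiable ℝ (fun x => g (x, q))) (i : Fin 3) :
    xPartial i (f * g) = xPartial i f * g + f * xPartial i g := by
  funext p
  have := fderiv_mul (hf p.2 p.1) (hg p.2 p.1)
  have := congrArg (fun M => M (EuclideanSpace.single i (1 : ℝ))) this
  refine Eq.trans this ?_
  simp [xPartial]
  ring

theorem IsXCk.add {k : ℕ} {f g : Pt → ℝ} (hf : IsXCk k f) (hg : IsXCk k g) :
    IsXCk k (f + g) := by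
  induction k generalizing f g with
  | zero => exact Continuous.add hf hg
  | succ k ih =>
    refine ⟨hf.1.add hg.1, fun q => (hf.2.1 q).add (hg.2.1 q), fun i => ?_⟩
    rw [xPartial_add hf.2.1 hg.2.1]
    exact ih (hf.2.2 i) (hg.2.2 i)

theorem IsXCk.mul {k : ℕ} {f g : Pt → ℝ} (hf : IsXCk k f) (hg : IsXCk k g) :
    IsXCk k (f * g) := by
  induction k generalizing f g with
  | zero => exact Continuous.mul hf hg
  | succ k ih =>
    refine ⟨hf.1.mul hg.1, fun q => (hf.2.1 q).mul (hg.2.1 q), fun i => ?_⟩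
    rw [xPartial_mul hf.2.1 hg.2.1]
    exact (ih (hf.2.2 i) hg.of_succ).add (ih hf.of_succ (hg.2.2 i))

theorem sum_single_smul (v : E3) : v = ∑ i, v i • EuclideanSpace.single i (1 : ℝ) := by
  ext j
  simp [Finset.sum_apply, Pi.single_apply]

theorem fderiv_slice_eq_sum (f : Pt → ℝ) (p : Pt) (v : E3) :
    fderiv ℝ (fun x => f (x, p.2)) p.1 v = ∑ i, v i * xPartial i f p := by
  conv_lhs => rw [sum_single_smul v]
  simp [map_sum, xPartial]

/-- In finite dimension `C^{k+1}` can be tested on directional derivatives, and each of these is a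
linear combination of coordinate partials. -/
theorem IsXCk.sliceContDiff {k : ℕ} {f : Pt → ℝ} (h : IsXCk k f) : SliceContDiff k f := by
  induction k generalizing f with
  | zero =>
    intro q
    have h0 : Continuous f := h
    have h1 : ContDiff ℝ 0 (fun x => f (x, q)) :=
      contDiff_zero.mpr (h0.comp (Continuous.prodMk_left q))
    exact_mod_cast h1
  | succ k ih =>
    intro q
    have : ContDiff ℝ ((k : WithTop ℕ∞) + 1) (fun x => f (x, q)) := by
      refine contDiff_succ_iff_fderiv_apply.mpr ⟨h.2.1 q, by simp, fun y => ?_⟩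
      have h1 : (fun x => fderiv ℝ (fun x => f (x, q)) x y) =
          fun x => ∑ i, y i * xPartial i f (x, q) :=
        funext fun x => fderiv_slice_eq_sum f (x, q) y
      rw [h1]
      exact ContDiff.sum fun i _ => contDiff_const.mul (ih (h.2.2 i) q)
    exact_mod_cast this

theorem IsXCk.xPartials {k : ℕ} {J : List (Fin 3)} {f : Pt → ℝ} (h : IsXCk (k + J.length) f) :
    IsXCk k (xPartials J f) := by
  induction J generalizing f with
  | nil => exact h
  | cons i J ih => exact ih (h.2.2 i)

theorem IsXCk.spatialDeriv {k : ℕ} {a : Fin 3 → ℕ} {f : Pt → ℝ} (h : IsXCk (k + ∑ i, a i) f) :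
    IsXCk k (spatialDeriv a f) := by
  rw [spatialDeriv_eq_xPartials_sortedList (h.sliceContDiff.of_le (Nat.le_add_left _ _))]
  exact IsXCk.xPartials (by rwa [length_sortedList])

theorem xPartials_add {J : List (Fin 3)} {f g : Pt → ℝ} (hf : IsXCk J.length f)
    (hg : IsXCk J.length g) : xPartials J (f + g) = xPartials J f + xPartials J g := by
  induction J generalizing f g with
  | nil => rfl
  | cons i J ih =>
    simp only [Transport.xPartials]
    rw [xPartial_add hf.2.1 hg.2.1, ih (hf.2.2 i) (hg.2.2 i)]

/-- A weak form of the Leibniz rule. -/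
theorem abs_xPartials_mul_le {J : List (Fin 3)} {f g : Pt → ℝ} (hf : IsXCk J.length f)
    (hg : IsXCk J.length g) {p : Pt} {M N : ℝ}
    (hM : ∀ K : List (Fin 3), K.length ≤ J.length → |xPartials K f p| ≤ M)
    (hN : ∀ K : List (Fin 3), K.length ≤ J.length → |xPartials K g p| ≤ N) :
    |xPartials J (f * g) p| ≤ 2 ^ J.length * (M * N) := by
  induction J generalizing f g with
  | nil =>
    have h1 := hM [] le_rfl
    have h2 := hN [] le_rfl
    simp only [xPartials, List.length_nil, pow_zero, one_mul, Pi.mul_apply, abs_mul] at *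
    exact mul_le_mul h1 h2 (abs_nonneg _) ((abs_nonneg _).trans h1)
  | cons i J ih =>
    -- Each differentiation splits a product into two, which doubles the bound and produces the
    -- factor `2 ^ J.length`.
    have e : xPartials (i :: J) (f * g) =
        xPartials J (xPartial i f * g) + xPartials J (f * xPartial i g) := by
      rw [← xPartials_add ((hf.2.2 i).mul hg.of_succ) (hf.of_succ.mul (hg.2.2 i)),
        ← xPartial_mul hf.2.1 hg.2.1]
      rfl
    have h1 := ih (hf.2.2 i) hg.of_succ
      (fun K hK => hM (i :: K) (by simpa using hK)) (fun K hK => hN K (hK.trans (by simp)))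
    have h2 := ih hf.of_succ (hg.2.2 i) (fun K hK => hM K (hK.trans (by simp)))
      (fun K hK => hN (i :: K) (by simpa using hK))
    rw [e, Pi.add_apply, List.length_cons, pow_succ]
    calc _ ≤ _ := abs_add_le _ _
      _ ≤ 2 ^ J.length * (M * N) + 2 ^ J.length * (M * N) := add_le_add h1 h2
      _ = _ := by ring

/-! ### Comparison of `IsCk0` and `IsXCk` -/

theorem IsCk0.sliceContDiff {k : ℕ} {f : Pt → ℝ} (h : IsCk0 k f) : SliceContDiff k f :=
  fun q => by simpa using h.contDiff q

theorem IsCk0.of_le {k l : ℕ∞} {f : Pt → ℝ} (h : IsCk0 l f) (hk : k ≤ l) : IsCk0 k f where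
  contDiff q := (h.contDiff q).of_le (by exact_mod_cast hk)
  continuous a ha := h.continuous a (ha.trans hk)
  hasCompactSupport := h.hasCompactSupport

theorem IsCk0.continuous_xPartials {k : ℕ} {f : Pt → ℝ} (h : IsCk0 k f) {J : List (Fin 3)}
    (hJ : J.length ≤ k) : Continuous (xPartials J f) := by
  rw [← spatialDeriv_eq_xPartials (a := fun i => J.count i) (fun _ => rfl)
    (h.sliceContDiff.of_le hJ)]
  refine h.continuous _ ?_
  rw [← length_eq_of_count (J := J) fun _ => rfl]
  exact_mod_cast hJ

theorem isXCk_of_continuous_xPartials {k : ℕ} {f : Pt → ℝ} (hs : SliceContDiff k f)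
    (hc : ∀ J : List (Fin 3), J.length ≤ k → Continuous (xPartials J f)) : IsXCk k f := by
  induction k generalizing f with
  | zero => exact hc [] le_rfl
  | succ k ih =>
    exact ⟨hc [] (Nat.zero_le _), hs.differentiable, fun i => ih (hs.xPartial i)
      fun J hJ => hc (i :: J) (by simpa using hJ)⟩

theorem IsCk0.isXCk {k : ℕ} {f : Pt → ℝ} (h : IsCk0 k f) : IsXCk k f :=
  isXCk_of_continuous_xPartials h.sliceContDiff fun _ hJ => h.continuous_xPartials hJ

theorem IsXCk.isCk0 {k : ℕ} {f : Pt → ℝ} (h : IsXCk k f) (hc : HasCompactSupport f) :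
    IsCk0 k f where
  contDiff q := by simpa using h.sliceContDiff q
  continuous a ha := by
    have ha' : ∑ i, a i ≤ k := by exact_mod_cast ha
    exact (IsXCk.spatialDeriv (k := 0) (h.of_le (by simpa using ha'))).continuous
  hasCompactSupport := hc

theorem hasCompactSupport_xPartial {f : Pt → ℝ} (hf : HasCompactSupport f) (i : Fin 3) :
    HasCompactSupport (xPartial i f) := by
  refine hf.mono' fun p hp => ?_
  by_contra hn
  refine hp ?_
  have h0 : f =ᶠ[nhds p] 0 := notMem_tsupport_iff_eventuallyEq.mp hn
  have hc : Filter.Tendsto (fun x : E3 => ((x, p.2) : Pt)) (nhds p.1) (nhds p) :=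
    (Continuous.prodMk_left p.2).tendsto p.1
  have h1 : (fun x : E3 => f (x, p.2)) =ᶠ[nhds p.1] fun _ => 0 := hc.eventually h0
  simp [xPartial, h1.fderiv_eq]

theorem IsCk0.xPartial {k : ℕ} {f : Pt → ℝ} (h : IsCk0 (k + 1 : ℕ) f) (i : Fin 3) :
    IsCk0 k (xPartial i f) :=
  (h.isXCk.2.2 i).isCk0 (hasCompactSupport_xPartial h.hasCompactSupport i)

theorem IsCk0.mul {k : ℕ} {f g : Pt → ℝ} (hf : IsCk0 k f) (hg : IsCk0 k g) :
    IsCk0 k (f * g) :=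
  (hf.isXCk.mul hg.isXCk).isCk0 hf.hasCompactSupport.mul_right

theorem streaming_eq_sum (f : Pt → ℝ) (p : Pt) :
    streaming f p = ∑ i, (p.2.1 : E3) i * xPartial i f p := fderiv_slice_eq_sum f p _

theorem IsCk0.streaming {k : ℕ} {f : Pt → ℝ} (h : IsCk0 (k + 1 : ℕ) f) :
    IsCk0 k (streaming f) := by
  have e : Transport.streaming f =
      ∑ i, (fun p : Pt => (p.2.1 : E3) i) * Transport.xPartial i f := by
    funext p
    simp [streaming_eq_sum]
  have h1 : ∀ i : Fin 3, IsCk0 k ((fun p : Pt => (p.2.1 : E3) i) * Transport.xPartial i f) :=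
    fun i => ((isXCk_const_in_x k (g := fun q : S2 × ℝ => (q.1 : E3) i) (by fun_prop)).mul
      (h.xPartial i).isXCk).isCk0 (h.xPartial i).hasCompactSupport.mul_left
  rw [e, Fin.sum_univ_three]
  exact ((h1 0).add (h1 1)).add (h1 2)

theorem xPartials_const_mul {J : List (Fin 3)} (g : S2 × ℝ → ℝ) {f : Pt → ℝ}
    (hf : SliceContDiff J.length f) :
    xPartials J ((fun p : Pt => g p.2) * f) = (fun p : Pt => g p.2) * xPartials J f := by
  induction J generalizing f with
  | nil => rfl
  | cons i J ih =>
    simp only [xPartials]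
    rw [xPartial_mul (fun q => differentiable_const (g q)) hf.differentiable, xPartial_const_in_x]
    have : ((fun _ => 0 : Pt → ℝ) * f + (fun p : Pt => g p.2) * Transport.xPartial i f) =
        (fun p : Pt => g p.2) * Transport.xPartial i f := by
      funext p
      simp
    rw [this, ih (hf.xPartial i)]

/-- Spatial derivatives commute with the streaming operator. -/
theorem spatialDeriv_streaming {f : Pt → ℝ} {a : Fin 3 → ℕ} (hf : IsXCk (∑ i, a i + 1) f) :
    spatialDeriv a (streaming f) = streaming (spatialDeriv a f) := by
  have e : streaming f = (((fun p : Pt => (p.2.1 : E3) 0) * xPartial 0 f +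
      (fun p : Pt => (p.2.1 : E3) 1) * xPartial 1 f) +
      (fun p : Pt => (p.2.1 : E3) 2) * xPartial 2 f) := by
    funext p
    simp [streaming_eq_sum, Fin.sum_univ_three]
  have hl := length_sortedList a
  have hm : ∀ i : Fin 3, IsXCk (∑ i, a i) ((fun p : Pt => (p.2.1 : E3) i) * xPartial i f) :=
    fun i => (isXCk_const_in_x _ (g := fun q : S2 × ℝ => (q.1 : E3) i) (by fun_prop)).mul
      (hf.2.2 i)
  have hst : IsXCk (∑ i, a i) (streaming f) := e ▸ ((hm 0).add (hm 1)).add (hm 2)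
  -- Moving `i` from the front to the back of the list is a permutation of `|a| + 1` directions,
  -- hence the extra order of regularity.
  have hc : ∀ i : Fin 3, xPartials (sortedList a) (xPartial i f) =
      xPartial i (xPartials (sortedList a) f) := fun i => by
    have := xPartials_append (sortedList a) [i] f
    rw [← show xPartials (i :: sortedList a) f = xPartials (sortedList a) (xPartial i f) from rfl,
      xPartials_perm (show (i :: sortedList a).Perm (sortedList a ++ [i]) from
        List.perm_append_comm (l₁ := [i])) (hf.sliceContDiff.of_le (by simp [hl])), this]
    rfl
  funext p
  rw [spatialDeriv_eq_xPartials_sortedList hst.sliceContDiff,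
    spatialDeriv_eq_xPartials_sortedList hf.of_succ.sliceContDiff, e,
    xPartials_add (by rw [hl]; exact (hm 0).add (hm 1)) (by rw [hl]; exact hm 2),
    xPartials_add (by rw [hl]; exact hm 0) (by rw [hl]; exact hm 1),
    xPartials_const_mul (fun q : S2 × ℝ => (q.1 : E3) 0)
      (by rw [hl]; exact (hf.2.2 0).sliceContDiff),
    xPartials_const_mul (fun q : S2 × ℝ => (q.1 : E3) 1)
      (by rw [hl]; exact (hf.2.2 1).sliceContDiff),
    xPartials_const_mul (fun q : S2 × ℝ => (q.1 : E3) 2)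
      (by rw [hl]; exact (hf.2.2 2).sliceContDiff), streaming_eq_sum, Fin.sum_univ_three]
  simp only [hc, Pi.add_apply, Pi.mul_apply]

/-! ### The streaming term is nonnegative on functions vanishing at the inflow boundary -/

/-- If the `C¹` function `u` vanishes at every point where a line with direction `ω` enters the
open set `G`, then `∫_G (∂_ω u) u ≥ 0`. -/
theorem setIntegral_fderiv_mul_self_nonneg {G : Set E3} (hG : IsOpen G)
    (hfin : volume G ≠ ⊤) {u : E3 → ℝ} (hu : ContDiff ℝ 1 u) (hc : HasCompactSupport u) (θ : E3)
    (h0 : ∀ x ∈ G, ∀ a : ℝ, 0 < a → (∀ s ∈ Ico 0 a, x - s • θ ∈ G) → x - a • θ ∉ G →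
      u (x - a • θ) = 0) :
    0 ≤ ∫ x in G, fderiv ℝ u x θ * u x := by
  set w : E3 → ℝ := fun x => u x * u x with hw
  have hwC : ContDiff ℝ 1 w := hu.mul hu
  have hwc : HasCompactSupport w := hc.mul_left
  have hwd : Differentiable ℝ w := hwC.differentiable (by norm_num)
  have hw0 : ∀ x, 0 ≤ w x := fun x => mul_self_nonneg _
  obtain ⟨L₀, hL₀⟩ := (hwc.fderiv (𝕜 := ℝ)).exists_bound_of_continuous
    (hwC.continuous_fderiv (by norm_num))
  have hL₀0 : 0 ≤ L₀ := (norm_nonneg _).trans (hL₀ 0)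
  set L := L₀ * ‖θ‖ with hL
  have hlip : ∀ (x : E3) (h : ℝ), 0 ≤ h → w x - w (x - h • θ) ≤ L * h := by
    intro x h hh
    have := convex_univ.norm_image_sub_le_of_norm_fderiv_le (𝕜 := ℝ) (f := w) (C := L₀)
      (fun z _ => hwd z) (fun z _ => hL₀ z) (mem_univ (x - h • θ)) (mem_univ x)
    rw [sub_sub_cancel, norm_smul, Real.norm_of_nonneg hh] at this
    calc _ ≤ ‖w x - w (x - h • θ)‖ := Real.le_norm_self _
      _ ≤ _ := this
      _ = L * h := by rw [hL]; ring
  -- Extending `w = u²` by zero turns the sign of the boundary term into monotonicity of an integral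
  -- under translation.
  set v : E3 → ℝ := G.indicator w with hv
  have hup : ∀ x ∈ G, ∀ h : ℝ, 0 ≤ h → v x - v (x - h • θ) ≤ L * h := by
    intro x hx h hh
    by_cases hxh : x - h • θ ∈ G
    · rw [hv, indicator_of_mem hx, indicator_of_mem hxh]
      exact hlip x h hh
    · rw [hv, indicator_of_mem hx, indicator_of_notMem hxh, sub_zero]
      -- Going backwards from `x`, let `a` be the first time at which the line leaves `G`. There `u
      -- = 0`, so `w x` is at most `L * a ≤ L * h`.
      have hcl : IsCompact (Icc 0 h ∩ (fun s : ℝ => x - s • θ) ⁻¹' Gᶜ) :=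
        isCompact_Icc.inter_right (hG.isClosed_compl.preimage (by fun_prop))
      obtain ⟨a, ⟨⟨ha0, hah⟩, haG⟩, hle⟩ := hcl.exists_isLeast ⟨h, ⟨hh, le_rfl⟩, hxh⟩
      have ha : 0 < a := by
        refine lt_of_le_of_ne ha0 fun e => haG ?_
        simpa [← e] using hx
      have hu0 : u (x - a • θ) = 0 := by
        refine h0 x hx a ha (fun s hs => ?_) haG
        by_contra hsG
        exact absurd (hle ⟨⟨hs.1, hs.2.le.trans hah⟩, hsG⟩) (not_le.mpr hs.2)
      have h1 := hlip x a ha0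
      have h2 : w (x - a • θ) = 0 := by simp [hw, hu0]
      rw [h2, sub_zero] at h1
      exact h1.trans (mul_le_mul_of_nonneg_left hah (by positivity))
  have hvint : Integrable v :=
    (hwC.continuous.integrable_of_hasCompactSupport hwc).indicator hG.measurableSet
  have hvm : Measurable v := hwC.continuous.measurable.indicator hG.measurableSet
  have hv0 : ∀ x, 0 ≤ v x := indicator_nonneg fun x _ => hw0 x
  set r : ℕ → ℝ := fun n => 1 / ((n : ℝ) + 1) with hr
  have hr0 : ∀ n, 0 < r n := fun n => Nat.one_div_pos_of_nat
  -- The truncation at `-L` supplies the lower half of the dominating bound. It can only increase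
  -- the integrals, and it leaves the limit unchanged since the derivative of `w` along `θ` is at
  -- least `-L`.
  set F : ℕ → E3 → ℝ := fun n x => max ((v x - v (x - r n • θ)) / r n) (-L) with hF
  have hL0 : 0 ≤ L := by positivity
  have hFb : ∀ n, ∀ x ∈ G, ‖F n x‖ ≤ L := by
    intro n x hx
    rw [Real.norm_eq_abs, abs_le]
    refine ⟨le_max_right _ _, max_le ?_ (by linarith)⟩
    rw [div_le_iff₀ (hr0 n)]
    exact hup x hx _ (hr0 n).le
  have : IsFiniteMeasure (volume.restrict G) := isFiniteMeasure_restrict.mpr hfin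
  have hFm : ∀ n, Measurable (F n) := fun n =>
    ((hvm.sub (hvm.comp (measurable_id.sub_const _))).div_const _).max measurable_const
  have hlim : Filter.Tendsto (fun n => ∫ x in G, F n x) Filter.atTop
      (nhds (∫ x in G, fderiv ℝ w x θ)) := by
    refine tendsto_integral_of_dominated_convergence (fun _ => L)
      (fun n => (hFm n).aestronglyMeasurable) (integrable_const _)
      (fun n => (ae_restrict_mem hG.measurableSet).mono fun x hx => hFb n x hx) ?_
    refine (ae_restrict_mem hG.measurableSet).mono fun x hx => ?_
    have hrt : Filter.Tendsto r Filter.atTop (nhds 0) := tendsto_one_div_add_atTop_nhds_zero_nat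
    have hd : HasDerivAt (fun s : ℝ => w (x + s • θ)) (fderiv ℝ w x θ) 0 :=
      (hwd x).hasFDerivAt.hasLineDerivAt θ
    have h1 : Filter.Tendsto (fun n => -r n) Filter.atTop (nhdsWithin 0 {0}ᶜ) := by
      refine tendsto_nhdsWithin_iff.mpr ⟨by simpa using hrt.neg, ?_⟩
      exact Filter.Eventually.of_forall fun n => by simpa using (hr0 n).ne'
    have h2 := hd.tendsto_slope_zero.comp h1
    have hx' : ∀ᶠ n in Filter.atTop, x - r n • θ ∈ G := by
      have : Filter.Tendsto (fun n => x - r n • θ) Filter.atTop (nhds x) := by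
        simpa using tendsto_const_nhds.sub (hrt.smul_const θ)
      exact this.eventually (hG.mem_nhds hx)
    have h3 : Filter.Tendsto (fun n => (v x - v (x - r n • θ)) / r n) Filter.atTop
        (nhds (fderiv ℝ w x θ)) := by
      refine h2.congr' (hx'.mono fun n hn => ?_)
      simp only [Function.comp_apply, hv, indicator_of_mem hx, indicator_of_mem hn, zero_add,
        zero_smul, add_zero, smul_eq_mul, neg_smul, ← sub_eq_add_neg]
      have := (hr0 n).ne'
      field_simp
      ring
    have h4 : -L ≤ fderiv ℝ w x θ := by
      have : ‖fderiv ℝ w x θ‖ ≤ L :=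
        ((fderiv ℝ w x).le_opNorm θ).trans (mul_le_mul_of_nonneg_right (hL₀ x) (norm_nonneg _))
      exact (abs_le.mp this).1
    have h5 := h3.max (tendsto_const_nhds (x := -L))
    rwa [max_eq_left h4] at h5
  have hpos : ∀ n, 0 ≤ ∫ x in G, F n x := by
    intro n
    have hvs : Integrable (fun x => v (x - r n • θ)) := hvint.comp_sub_right _
    -- Since `v ≥ 0` vanishes off `G`, enlarging the left integral to the whole space and
    -- translating back gives the right one.
    have h1 : ∫ x in G, v (x - r n • θ) ≤ ∫ x in G, v x := by
      calc _ ≤ ∫ x, v (x - r n • θ) := setIntegral_le_integral hvs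
            (Filter.Eventually.of_forall fun x => hv0 _)
        _ = ∫ x, v x := integral_sub_right_eq_self v _
        _ = ∫ x in G, v x := by
          rw [hv, integral_indicator hG.measurableSet, setIntegral_indicator hG.measurableSet,
            inter_self]
    have hint : Integrable (fun x => (v x - v (x - r n • θ)) / r n) (volume.restrict G) :=
      ((hvint.sub hvs).div_const _).integrableOn
    calc 0 ≤ (∫ x in G, v x - v (x - r n • θ)) / r n := by
          rw [integral_sub hvint.integrableOn hvs.integrableOn]
          exact div_nonneg (sub_nonneg.mpr h1) (hr0 n).le
      _ = ∫ x in G, (v x - v (x - r n • θ)) / r n := (integral_div _ _).symm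
      _ ≤ ∫ x in G, F n x := by
        refine integral_mono hint ?_ fun x => le_max_left _ _
        exact Integrable.of_bound (hFm n).aestronglyMeasurable L
          ((ae_restrict_mem hG.measurableSet).mono fun x hx => hFb n x hx)
  have hfin := ge_of_tendsto' hlim hpos
  have he : ∀ x, fderiv ℝ w x θ = 2 * (fderiv ℝ u x θ * u x) := by
    intro x
    have hud := hu.differentiable (by norm_num) x
    have : fderiv ℝ w x = u x • fderiv ℝ u x + u x • fderiv ℝ u x := fderiv_mul hud hud
    rw [this]
    simp
    ring
  simp only [he, integral_const_mul] at hfin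
  linarith

/-! ### Entry points of lines and the inflow boundary -/

namespace Domain

variable {D : Domain}

/-- A boundary point through which a line with direction `ω` enters `G` lies on the inflow or
characteristic boundary. -/
theorem mem_inflow_of_entry {x : E3} {q : S2 × ℝ} (hq : q.2 ∈ Icc D.E₀ D.E₁) {a : ℝ}
    (ha : 0 < a) (hs : ∀ s ∈ Ico 0 a, x - s • (q.1 : E3) ∈ D.G) (hy : x - a • (q.1 : E3) ∉ D.G) :
    ((x - a • (q.1 : E3), q) : Pt) ∈ D.Γminus ∪ D.Γzero := by
  set θ : E3 := (q.1 : E3)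
  set y := x - a • θ with hydef
  have hyt : ∀ t ∈ Ioc 0 a, y + t • θ ∈ D.G := by
    intro t ht
    have := hs (a - t) ⟨by linarith [ht.2], by linarith [ht.1]⟩
    rwa [show x - (a - t) • θ = y + t • θ by rw [hydef]; module] at this
  have hIoc : ∀ᶠ t : ℝ in nhdsWithin 0 (Ioi 0), t ∈ Ioc 0 a := Ioc_mem_nhdsGT ha
  have htend : Filter.Tendsto (fun t : ℝ => y + t • θ) (nhdsWithin 0 (Ioi 0)) (nhds y) := by
    have : Continuous fun t : ℝ => y + t • θ := by fun_prop
    have h1 := this.tendsto 0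
    simp only [zero_smul, add_zero] at h1
    exact h1.mono_left nhdsWithin_le_nhds
  have hfr : y ∈ frontier D.G := by
    rw [D.isOpen.frontier_eq]
    exact ⟨mem_closure_of_tendsto htend (hIoc.mono fun t ht => hyt t ht), hy⟩
  obtain ⟨φ, U, hU, hyU, hφ, hgrad, hiff⟩ := D.smooth_boundary y hfr
  have hd : DifferentiableAt ℝ φ y :=
    (hφ.differentiableOn (by norm_num)).differentiableAt (hU.mem_nhds hyU)
  have hneg : ∀ᶠ t : ℝ in nhdsWithin 0 (Ioi 0), φ (y + t • θ) < 0 := by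
    filter_upwards [hIoc, htend.eventually (hU.mem_nhds hyU)] with t ht htU
    exact (hiff _ htU).mp (hyt t ht)
  have hy0 : 0 ≤ φ y := not_lt.mp fun h => hy ((hiff y hyU).mpr h)
  have hder : HasDerivAt (fun s : ℝ => φ (y + s • θ)) (fderiv ℝ φ y θ) 0 :=
    hd.hasFDerivAt.hasLineDerivAt θ
  -- Here `φ y ≥ 0`, while `φ < 0` at `y + t • θ` for small `t > 0`; the right difference quotients
  -- are therefore nonpositive.
  have hle : fderiv ℝ φ y θ ≤ 0 := by
    have h1 := hder.tendsto_slope_zero.mono_left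
      (nhdsWithin_mono 0 (show Ioi (0 : ℝ) ⊆ {0}ᶜ from fun t ht => ne_of_gt ht))
    refine le_of_tendsto h1 ?_
    filter_upwards [hneg, self_mem_nhdsWithin] with t ht ht0
    simp only [zero_add, zero_smul, add_zero, smul_eq_mul]
    exact mul_nonpos_of_nonneg_of_nonpos (inv_nonneg.mpr (le_of_lt ht0)) (by linarith)
  have hn : inner ℝ θ (‖gradient φ y‖⁻¹ • gradient φ y) ≤ 0 := by
    rw [inner_smul_right, real_inner_comm, inner_gradient_left]
    exact mul_nonpos_of_nonneg_of_nonpos (by positivity) hle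
  have hnorm : IsOutwardUnitNormal D.G y (‖gradient φ y‖⁻¹ • gradient φ y) :=
    ⟨φ, ⟨U, hU, hyU, hφ, hgrad, hiff⟩, rfl⟩
  rcases hn.lt_or_eq with h | h
  · exact Or.inl ⟨hfr, hq, _, hnorm, h⟩
  · exact Or.inr ⟨hfr, hq, _, hnorm, h⟩

/-- Spatial derivatives of (an extension of) a test function vanish at the points where the line
with direction `ω` enters `G`. -/
theorem spatialDeriv_eq_zero_of_entry {ψ f : Pt → ℝ}
    (hsupp : D.supp ψ ∩ (D.Γminus ∪ D.Γzero) = ∅) (he : EqOn ψ f D.Ω) {α : Fin 3 → ℕ}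
    (hcont : Continuous (spatialDeriv α f))
    {x : E3} {q : S2 × ℝ} (hq : q.2 ∈ Ioo D.E₀ D.E₁) {a : ℝ}
    (ha : 0 < a) (hs : ∀ s ∈ Ico 0 a, x - s • (q.1 : E3) ∈ D.G) (hy : x - a • (q.1 : E3) ∉ D.G) :
    spatialDeriv α f (x - a • (q.1 : E3), q) = 0 := by
  have hm := mem_inflow_of_entry (Ioo_subset_Icc_self hq) ha hs hy
  have hns : ((x - a • (q.1 : E3), q) : Pt) ∉ D.supp ψ := fun h =>
    eq_empty_iff_forall_notMem.mp hsupp _ ⟨h, hm⟩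
  have hcl : IsClosed (D.supp ψ) := isClosed_closure
  have hcurve : Continuous fun s : ℝ => ((x - s • (q.1 : E3), q) : Pt) := by fun_prop
  have htend : Filter.Tendsto (fun s : ℝ => ((x - s • (q.1 : E3), q) : Pt)) (nhdsWithin a (Iio a))
      (nhds (x - a • (q.1 : E3), q)) := (hcurve.tendsto a).mono_left nhdsWithin_le_nhds
  -- The extension `f` is tied to `ψ` only inside `Ω`, so the boundary point is approached from
  -- within along the line, and continuity carries the zero over.
  have h1 : ∀ᶠ s in nhdsWithin a (Iio a), spatialDeriv α f (x - s • (q.1 : E3), q) = 0 := by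
    filter_upwards [htend.eventually (hcl.isOpen_compl.mem_nhds hns), Ico_mem_nhdsLT ha]
      with s hs1 hs2
    have hΩ : ((x - s • (q.1 : E3), q) : Pt) ∈ D.Ω := ⟨hs s hs2, mem_univ _, hq⟩
    rw [← spatialDeriv_congr he α hΩ]
    have hsl : Filter.Tendsto (fun z : E3 => ((z, q) : Pt)) (nhds (x - s • (q.1 : E3)))
      (nhds (x - s • (q.1 : E3), q)) := (Continuous.prodMk_left q).tendsto _
    have h2 : (fun z : E3 => ψ (z, q)) =ᶠ[nhds (x - s • (q.1 : E3))] fun _ => 0 := by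
      filter_upwards [hsl.eventually (hcl.isOpen_compl.mem_nhds hs1), mem_nhds_slice hΩ]
        with z hz1 hz2
      by_contra hne
      exact hz1 (subset_closure ⟨hz2, hne⟩)
    have h3 := (h2.iteratedFDeriv ℝ (∑ i, α i)).eq_of_nhds
    have h4 := iteratedFDeriv_fun_zero (𝕜 := ℝ) (E := E3) (F := ℝ) (n := ∑ i, α i)
    simp only [spatialDeriv, h3]
    simp [h4]
  exact tendsto_nhds_unique ((hcont.tendsto _).comp htend)
    (tendsto_const_nhds.congr' (h1.mono fun s hs => hs.symm))

/-! ### The product structure of the measure and the sign of the streaming term -/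

/-- The measure `dω dE` on `S × I°`. -/
noncomputable def angleEnergyMeasure (D : Domain) : Measure (S2 × ℝ) :=
  (((volume : Measure E3).toSphere).prod (volume : Measure ℝ)).restrict (univ ×ˢ Ioo D.E₀ D.E₁)

theorem μ_eq (D : Domain) :
    D.μ = ((volume : Measure E3).restrict D.G).prod D.angleEnergyMeasure := by
  rw [μ, Ω, angleEnergyMeasure, Measure.prod_restrict]

instance : IsFiniteMeasure ((volume : Measure E3).restrict D.G) :=
  isFiniteMeasure_restrict.mpr D.isBounded.measure_lt_top.ne

instance : IsFiniteMeasure D.angleEnergyMeasure := by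
  refine isFiniteMeasure_restrict.mpr ?_
  rw [Measure.prod_prod]
  exact ENNReal.mul_ne_top (measure_ne_top _ _) (by simp)

instance : IsFiniteMeasure D.μ := by
  rw [μ_eq]
  infer_instance

/-- By Fubini it suffices to fix `(ω, E)` and apply `setIntegral_fderiv_mul_self_nonneg` to the
slice in `x`, which vanishes at every entry point. -/
theorem integral_streaming_mul_nonneg {ψ f : Pt → ℝ}
    (hsupp : D.supp ψ ∩ (D.Γminus ∪ D.Γzero) = ∅) (he : EqOn ψ f D.Ω) {α : Fin 3 → ℕ}
    (hf : IsCk0 ((∑ i, α i) + 1 : ℕ) f) :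
    0 ≤ ∫ p, streaming (spatialDeriv α f) p * spatialDeriv α f p ∂D.μ := by
  set g := spatialDeriv α f with hg
  have hg1 : IsXCk 1 g := IsXCk.spatialDeriv (by rw [add_comm]; exact hf.isXCk)
  have hgc : HasCompactSupport g := hf.hasCompactSupport_spatialDeriv α
  have hgk : IsCk0 (0 + 1 : ℕ) g := hg1.isCk0 hgc
  have hint : Integrable (fun p => streaming g p * g p) D.μ := by
    refine Integrable.integrableOn (Continuous.integrable_of_hasCompactSupport ?_ ?_)
    · exact hgk.streaming.isXCk.continuous.mul hg1.continuous
    · exact hgc.mul_left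
  rw [μ_eq] at hint ⊢
  rw [integral_prod_symm _ hint]
  refine setIntegral_nonneg (MeasurableSet.univ.prod measurableSet_Ioo) fun q hq => ?_
  have hslice : HasCompactSupport fun x => g (x, q) := by
    refine HasCompactSupport.of_support_subset_isCompact (hgc.isCompact.image continuous_fst) ?_
    intro x hx
    exact ⟨(x, q), subset_tsupport _ hx, rfl⟩
  refine setIntegral_fderiv_mul_self_nonneg D.isOpen D.isBounded.measure_lt_top.ne
    (by exact_mod_cast hg1.sliceContDiff q) hslice (q.1 : E3) fun x hx a ha hs hy => ?_
  exact spatialDeriv_eq_zero_of_entry hsupp he hg1.continuous hq.2 ha hs hy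

/-! ### Stability of the test space under streaming and multiplication -/

theorem support_streaming_subset (ψ : Pt → ℝ) : D.supp (streaming ψ) ⊆ D.supp ψ := by
  refine closure_minimal ?_ isClosed_closure
  rintro p ⟨hp, hne⟩
  by_contra hn
  refine hne ?_
  have hsl : Filter.Tendsto (fun z : E3 => ((z, p.2) : Pt)) (nhds p.1) (nhds p) :=
    (Continuous.prodMk_left p.2).tendsto _
  have h2 : (fun z : E3 => ψ (z, p.2)) =ᶠ[nhds p.1] fun _ => 0 := by
    filter_upwards [hsl.eventually (isClosed_closure.isOpen_compl.mem_nhds hn), mem_nhds_slice hp]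
      with z hz1 hz2
    by_contra hne
    exact hz1 (subset_closure ⟨hz2, hne⟩)
  simp [streaming, h2.fderiv_eq]

/-- Streaming costs one derivative, which the intersection over all `k` absorbs. -/
theorem streaming_mem_testSpace {ψ : Pt → ℝ} (hψ : ψ ∈ D.testSpace) :
    streaming ψ ∈ D.testSpace := by
  intro k hk
  obtain ⟨⟨f, hf, he⟩, hsupp⟩ := hψ (k + 1) (by omega)
  refine ⟨⟨streaming f, hf.streaming, streaming_congr he⟩, ?_⟩
  rw [← subset_empty_iff, ← hsupp]
  exact inter_subset_inter_left _ (support_streaming_subset ψ)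

theorem mul_mem_testSpace {φ ψ : Pt → ℝ} (hφ : φ ∈ D.smoothSpace) (hψ : ψ ∈ D.testSpace) :
    φ * ψ ∈ D.testSpace := by
  intro k hk
  obtain ⟨⟨f, hf, he⟩, hsupp⟩ := hψ k hk
  obtain ⟨g, hg, he'⟩ := hφ
  refine ⟨⟨g * f, (hg.of_le le_top).mul hf, fun p hp => by simp [he hp, he' hp]⟩, ?_⟩
  rw [← subset_empty_iff, ← hsupp]
  refine inter_subset_inter_left _ (closure_mono (inter_subset_inter_right _ ?_))
  exact Function.support_mul_subset_right φ ψ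

theorem coeFn_jet2 (m : ℕ) (ψ : D.testSpace) (α : MultiIndex m) :
    D.jet2 m ψ α =ᵐ[D.μ] spatialDeriv α.exps ψ :=
  MemLp.coeFn_toLp ((isCkBar_of_mem_testSpace ψ.2 m).memLp 2 α.sum_exps_le)

/-- `ω · ∇ₓ ψ` as a test function. -/
noncomputable def streamingTest (ψ : D.testSpace) : D.testSpace :=
  ⟨streaming ψ, streaming_mem_testSpace ψ.2⟩

/-- Componentwise: once `∂^α` is commuted past the streaming operator, each summand is an integral
of the form treated in `integral_streaming_mul_nonneg`. -/
theorem inner_streamingTest_nonneg (m : ℕ) (ψ : D.testSpace) :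
    0 ≤ inner ℝ (D.toH0 m (streamingTest ψ)) (D.toH0 m ψ) := by
  have h : inner ℝ (D.toH0 m (streamingTest ψ)) (D.toH0 m ψ) =
      ∑ α, inner ℝ (D.jet2 m (streamingTest ψ) α) (D.jet2 m ψ α) := PiLp.inner_apply _ _
  rw [h]
  refine Finset.sum_nonneg fun α _ => ?_
  obtain ⟨⟨f, hf, he⟩, hsupp⟩ := ψ.2 ((∑ i, α.exps i) + 1) (by omega)
  rw [L2.inner_def]
  refine (integral_streaming_mul_nonneg hsupp he hf).trans_eq (integral_congr_ae ?_)
  filter_upwards [coeFn_jet2 m (streamingTest ψ) α, coeFn_jet2 m ψ α,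
    ae_restrict_mem measurableSet_Ω] with p h1 h2 hp
  rw [h1, h2, spatialDeriv_congr he _ hp,
    show ((streamingTest ψ : D.testSpace) : Pt → ℝ) = streaming ψ from rfl,
    spatialDeriv_congr (streaming_congr he) _ hp, spatialDeriv_streaming hf.isXCk]
  simp [mul_comm]

end Domain

/-! ### Weak derivatives: an element of `H₀` is determined by its underlying function -/

/-- Iterated integration by parts against a smooth compactly supported function. -/
theorem exists_integral_xPartials_mul_eq (J : List (Fin 3)) {χ : E3 → ℝ} (hχ : ContDiff ℝ ∞ χ)
    (hc : HasCompactSupport χ) :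
    ∃ χ' : E3 → ℝ, ContDiff ℝ ∞ χ' ∧ HasCompactSupport χ' ∧ tsupport χ' ⊆ tsupport χ ∧
      ∀ f, IsXCk J.length f → ∀ q : S2 × ℝ,
        ∫ x, xPartials J f (x, q) * χ x = ∫ x, f (x, q) * χ' x := by
  induction J with
  | nil => exact ⟨χ, hχ, hc, le_rfl, fun f _ q => rfl⟩
  | cons i J ih =>
    obtain ⟨χ₁, h1, h2, h3, h4⟩ := ih
    set v : E3 := EuclideanSpace.single i (1 : ℝ)
    have hd : ContDiff ℝ ∞ (fun x => fderiv ℝ χ₁ x v) :=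
      (contDiff_infty_iff_fderiv.mp h1).2.clm_apply contDiff_const
    have hcd : HasCompactSupport (fun x => fderiv ℝ χ₁ x v) := h2.fderiv_apply ℝ v
    refine ⟨fun x => -fderiv ℝ χ₁ x v, hd.neg, hcd.comp_left neg_zero, ?_, fun f hf q => ?_⟩
    · refine Subset.trans (closure_mono ?_) ((tsupport_fderiv_apply_subset ℝ v).trans h3)
      intro x hx
      simpa using hx
    · have hfd := hf.2.1 q
      have hfc : Continuous fun x => f (x, q) := hf.1.comp (Continuous.prodMk_left q)
      have hpc : Continuous fun x => xPartial i f (x, q) :=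
        (hf.2.2 i).continuous.comp (Continuous.prodMk_left q)
      have hχ1 := h1.continuous
      have key := integral_mul_fderiv_eq_neg_fderiv_mul_of_integrable (μ := (volume : Measure E3))
        (f := fun x => f (x, q)) (g := χ₁) (v := v)
        ((hpc.mul hχ1).integrable_of_hasCompactSupport h2.mul_left)
        ((hfc.mul hd.continuous).integrable_of_hasCompactSupport hcd.mul_left)
        ((hfc.mul hχ1).integrable_of_hasCompactSupport h2.mul_left)
        (fun x _ => hfd x) (fun x _ => h1.differentiable (by norm_num) x)
      have := h4 (xPartial i f) (hf.2.2 i) q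
      simp only [mul_neg, integral_neg, key, neg_neg]
      exact this

/-! ### Testing against products `χ(x) 1_B(ω, E)` -/

namespace Domain

variable {D : Domain}

/-- The tensor product of a function of `x` and the indicator function of a set of `(ω, E)`. -/
noncomputable def tensorIndicator (χ : E3 → ℝ) (B : Set (S2 × ℝ)) (p : Pt) : ℝ :=
  χ p.1 * B.indicator 1 p.2

theorem memLp_tensorIndicator {χ : E3 → ℝ} (hχ : Continuous χ) (hc : HasCompactSupport χ)
    {B : Set (S2 × ℝ)} (hB : MeasurableSet B) : MemLp (tensorIndicator χ B) 2 D.μ := by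
  obtain ⟨M, hM⟩ := hc.exists_bound_of_continuous hχ
  refine MemLp.of_bound (C := M) ?_ (Filter.Eventually.of_forall fun p => ?_)
  · exact ((hχ.measurable.comp measurable_fst).mul
      ((measurable_one.indicator hB).comp measurable_snd)).aestronglyMeasurable
  · rw [tensorIndicator, norm_mul]
    refine (mul_le_of_le_one_right (norm_nonneg _) ?_).trans (hM p.1)
    by_cases h : p.2 ∈ B <;> simp [h]

theorem setIntegral_eq_integral_of_tsupport_subset {χ : E3 → ℝ} (hs : tsupport χ ⊆ D.G)
    (g : E3 → ℝ) : ∫ x in D.G, g x * χ x = ∫ x, g x * χ x := by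
  refine setIntegral_eq_integral_of_forall_compl_eq_zero fun x hx => ?_
  rw [image_eq_zero_of_notMem_tsupport fun h => hx (hs h), mul_zero]

theorem integrable_mul_tensorIndicator {g : Pt → ℝ} (hg : Integrable g D.μ) {χ : E3 → ℝ}
    (hχ : Continuous χ) (hc : HasCompactSupport χ) {B : Set (S2 × ℝ)} (hB : MeasurableSet B) :
    Integrable (fun p => g p * tensorIndicator χ B p) D.μ := by
  obtain ⟨M, hM⟩ := hc.exists_bound_of_continuous hχ
  refine hg.mul_bdd (c := M) (memLp_tensorIndicator hχ hc hB).1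
    (Filter.Eventually.of_forall fun p => ?_)
  rw [tensorIndicator, norm_mul]
  refine (mul_le_of_le_one_right (norm_nonneg _) ?_).trans (hM p.1)
  by_cases h : p.2 ∈ B <;> simp [h]

/-- With `χ` supported in `G`, the inner integral runs over all of space, so integration by parts in
`x` leaves no boundary term. -/
theorem integral_mul_tensorIndicator {g : Pt → ℝ} (hg : Integrable g D.μ) {χ : E3 → ℝ}
    (hχ : Continuous χ) (hc : HasCompactSupport χ) (hs : tsupport χ ⊆ D.G) {B : Set (S2 × ℝ)}
    (hB : MeasurableSet B) :
    ∫ p, g p * tensorIndicator χ B p ∂D.μ =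
      ∫ q, (∫ x, g (x, q) * χ x) * B.indicator 1 q ∂D.angleEnergyMeasure := by
  have hint := integrable_mul_tensorIndicator hg hχ hc hB
  rw [μ_eq] at hint ⊢
  rw [integral_prod_symm _ hint]
  refine integral_congr_ae (Filter.Eventually.of_forall fun q => ?_)
  simp only [tensorIndicator, ← mul_assoc]
  rw [integral_mul_const, setIntegral_eq_integral_of_tsupport_subset hs]

/-- A function orthogonal to all products `χ(x) 1_B(ω, E)` vanishes. -/
theorem ae_eq_zero_of_integral_mul_tensorIndicator {g : Pt → ℝ} (hg : Integrable g D.μ)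
    (h : ∀ χ : E3 → ℝ, ContDiff ℝ ∞ χ → HasCompactSupport χ → tsupport χ ⊆ D.G →
      ∀ B : Set (S2 × ℝ), MeasurableSet B → ∫ p, g p * tensorIndicator χ B p ∂D.μ = 0) :
    g =ᵐ[D.μ] 0 := by
  have hg' : Integrable g (((volume : Measure E3).restrict D.G).prod D.angleEnergyMeasure) := by
    rwa [← μ_eq]
  have hrect : ∀ (A : Set E3) (B : Set (S2 × ℝ)), MeasurableSet A → MeasurableSet B →
      ∫ p in A ×ˢ B, g p ∂D.μ = 0 := by
    intro A B hA hB
    -- For fixed `B` the hypothesis says that `k` is orthogonal to all bump functions in `G`, so `k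
    -- = 0` a.e. there. This settles rectangles; a π-λ argument does the rest.
    set k : E3 → ℝ := fun x => ∫ q in B, g (x, q) ∂D.angleEnergyMeasure with hk
    have hgB : Integrable (fun p : Pt => g p * B.indicator 1 p.2)
        (((volume : Measure E3).restrict D.G).prod D.angleEnergyMeasure) := by
      refine hg'.mul_bdd (c := 1)
        ((measurable_one.indicator hB).comp measurable_snd).aestronglyMeasurable
        (Filter.Eventually.of_forall fun p => ?_)
      by_cases h : p.2 ∈ B <;> simp [h]
    have hkeq : ∀ x, k x = ∫ q, g (x, q) * B.indicator 1 q ∂D.angleEnergyMeasure := by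
      intro x
      rw [hk]
      simp only
      rw [← integral_indicator hB]
      refine integral_congr_ae (Filter.Eventually.of_forall fun q => ?_)
      by_cases h : q ∈ B <;> simp [h]
    have hkint : IntegrableOn k D.G := by
      have := hgB.integral_prod_left
      simp only [← hkeq] at this
      exact this
    have hk0 : ∀ᵐ x ∂(volume : Measure E3), x ∈ D.G → k x = 0 := by
      refine D.isOpen.ae_eq_zero_of_integral_contDiff_smul_eq_zero hkint.locallyIntegrableOn
        fun χ hχ hc hs => ?_
      have h0 := h χ hχ hc hs B hB
      have hint := integrable_mul_tensorIndicator hg hχ.continuous hc hB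
      rw [μ_eq] at h0 hint
      rw [integral_prod _ hint] at h0
      rw [← h0]
      simp only [smul_eq_mul, mul_comm (χ _)]
      rw [← setIntegral_eq_integral_of_tsupport_subset hs]
      refine integral_congr_ae (Filter.Eventually.of_forall fun x => ?_)
      simp only [tensorIndicator]
      rw [hkeq, ← integral_mul_const]
      refine integral_congr_ae (Filter.Eventually.of_forall fun q => ?_)
      ring
    rw [μ_eq, setIntegral_prod _ hg'.integrableOn]
    refine integral_eq_zero_of_ae (ae_restrict_of_ae ?_)
    exact (ae_restrict_iff' D.isOpen.measurableSet).mpr hk0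
  have hall : ∀ s, MeasurableSet s → ∫ p in s, g p ∂D.μ = 0 := by
    intro s hs
    induction s, hs using MeasurableSpace.induction_on_inter
      (generateFrom_prod (α := E3) (β := S2 × ℝ)).symm isPiSystem_prod with
    | empty => simp
    | basic t ht =>
      obtain ⟨A, hA, B, hB, rfl⟩ := ht
      exact hrect A B hA hB
    | compl t ht ih =>
      have h1 := integral_add_compl ht hg
      have h2 := hrect univ univ .univ .univ
      rw [univ_prod_univ, setIntegral_univ] at h2
      rw [ih, h2, zero_add] at h1
      exact h1
    | iUnion t hd ht ih =>
      rw [integral_iUnion ht hd hg.integrableOn]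
      simp [ih]
  exact hg.ae_eq_zero_of_forall_setIntegral_eq_zero fun s hs _ => hall s hs

theorem inner_toLp_right (u : Lp ℝ 2 D.μ) {g : Pt → ℝ} (hg : MemLp g 2 D.μ) :
    inner ℝ u (hg.toLp g) = ∫ p, u p * g p ∂D.μ := by
  rw [L2.inner_def]
  refine integral_congr_ae ?_
  filter_upwards [hg.coeFn_toLp] with p hp
  rw [hp]
  simp [mul_comm]

theorem spatialDeriv_zero {f : Pt → ℝ} (hf : SliceContDiff 0 f) : spatialDeriv 0 f = f :=
  spatialDeriv_eq_xPartials (J := []) (by simp) hf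

/-- The weak-derivative identity for test functions. That `χ'` is chosen before `B` and `ψ` is what
lets the identity pass to limits in `ψ`. -/
theorem integral_jet2_mul_tensorIndicator {m : ℕ} (α : MultiIndex m) {χ : E3 → ℝ}
    (hχ : ContDiff ℝ ∞ χ) (hc : HasCompactSupport χ) (hs : tsupport χ ⊆ D.G) :
    ∃ χ' : E3 → ℝ, ContDiff ℝ ∞ χ' ∧ HasCompactSupport χ' ∧
      ∀ B : Set (S2 × ℝ), MeasurableSet B → ∀ ψ : D.testSpace,
        ∫ p, D.jet2 m ψ α p * tensorIndicator χ B p ∂D.μ =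
          ∫ p, D.jet2 m ψ (MultiIndex.zero m) p * tensorIndicator χ' B p ∂D.μ := by
  obtain ⟨χ', h1, h2, h3, h4⟩ := exists_integral_xPartials_mul_eq (sortedList α.exps) hχ hc
  refine ⟨χ', h1, h2, fun B hB ψ => ?_⟩
  obtain ⟨⟨f, hf, he⟩, -⟩ := ψ.2 (m + 1) (by omega)
  have hα : ∑ i, α.exps i ≤ m + 1 := by exact_mod_cast α.sum_exps_le
  have hfx := hf.isXCk.of_le hα
  have hcomp : ∀ β : MultiIndex m, D.jet2 m ψ β =ᵐ[D.μ] spatialDeriv β.exps f := fun β =>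
    (coeFn_jet2 m ψ β).trans (ae_eq_of_eqOn (spatialDeriv_congr he _))
  have hint : ∀ β : MultiIndex m, Integrable (spatialDeriv β.exps f) D.μ := fun β =>
    ((Lp.memLp (D.jet2 m ψ β)).integrable (by norm_num)).congr (hcomp β)
  have hrw : ∀ (β : MultiIndex m) (k : E3 → ℝ),
      ∫ p, D.jet2 m ψ β p * tensorIndicator k B p ∂D.μ =
        ∫ p, spatialDeriv β.exps f p * tensorIndicator k B p ∂D.μ := fun β k =>
    integral_congr_ae ((hcomp β).mono fun p hp => by simp only [hp])
  have hz : spatialDeriv (MultiIndex.zero m).exps f = f :=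
    spatialDeriv_zero (hfx.sliceContDiff.of_le (Nat.zero_le _))
  rw [hrw, hrw, integral_mul_tensorIndicator (hint _) hχ.continuous hc hs hB,
    integral_mul_tensorIndicator (hint _) h1.continuous h2 (h3.trans hs) hB, hz,
    spatialDeriv_eq_xPartials_sortedList hfx.sliceContDiff]
  refine integral_congr_ae (Filter.Eventually.of_forall fun q => ?_)
  simp only
  rw [h4 f (by rwa [length_sortedList]) q]

/-- An element of `H₀` is determined by its underlying function. -/
theorem H0.fn_injective {m : ℕ} {u : D.H0 m} (hu : H0.fn u = 0) : u = 0 := by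
  ext α : 2
  refine (Lp.eq_zero_iff_ae_eq_zero).mpr ?_
  refine ae_eq_zero_of_integral_mul_tensorIndicator
    ((Lp.memLp _).integrable (by norm_num)) fun χ hχ hc hs B hB => ?_
  obtain ⟨χ', h1, h2, h3⟩ := integral_jet2_mul_tensorIndicator α hχ hc hs
  have hm := memLp_tensorIndicator (D := D) hχ.continuous hc hB
  have hm' := memLp_tensorIndicator (D := D) h1.continuous h2 hB
  -- The weak-derivative identity is a closed condition on jets and holds for test functions, hence
  -- on all of `H0`. A zero component at `α = 0` then forces every component to be orthogonal to the
  -- tensor products.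
  have hcl : IsClosed {w : D.Jet2 m | inner ℝ (w α) (hm.toLp _) =
      inner ℝ (w (MultiIndex.zero m)) (hm'.toLp _)} :=
    isClosed_eq ((PiLp.continuous_apply 2 _ α).inner continuous_const)
      ((PiLp.continuous_apply 2 _ _).inner continuous_const)
  have hsub : (D.H0 m : Set (D.Jet2 m)) ⊆ {w : D.Jet2 m | inner ℝ (w α) (hm.toLp _) =
      inner ℝ (w (MultiIndex.zero m)) (hm'.toLp _)} := by
    refine closure_minimal ?_ hcl
    rintro _ ⟨ψ, rfl⟩
    simp only [mem_ofPred_eq, inner_toLp_right]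
    exact h3 B hB ψ
  have := hsub u.2
  have hu' : (u : D.Jet2 m) (MultiIndex.zero m) = 0 := hu
  rw [mem_ofPred_eq, hu', inner_zero_left, inner_toLp_right] at this
  exact this

end Domain

theorem MultiIndex.exists_exps_eq_count {m : ℕ} {J : List (Fin 3)} (hJ : J.length ≤ m) :
    ∃ β : MultiIndex m, ∀ i, J.count i = β.exps i := by
  have hs : ∑ i, J.count i ≤ m := by rwa [← length_eq_of_count (J := J) fun _ => rfl]
  exact ⟨⟨fun i => ⟨J.count i, Nat.lt_succ_of_le (List.count_le_length.trans hJ)⟩, hs⟩,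
    fun _ => rfl⟩

namespace Domain

variable {D : Domain}

/-! ### Products with elements of `𝒲` -/

/-- The product of a smooth function and a test function, as a test function. -/
def mulTest (φ : D.smoothSpace) (ψ : D.testSpace) : D.testSpace :=
  ⟨(φ : Pt → ℝ) * ψ, mul_mem_testSpace φ.2 ψ.2⟩

theorem ae_norm_le_norm (s : Lp ℝ ∞ D.μ) : ∀ᵐ p ∂D.μ, ‖s p‖ ≤ ‖s‖ := by
  filter_upwards [ae_le_eLpNormEssSup (f := s) (μ := D.μ)] with p hp
  rw [Lp.norm_def, eLpNorm_exponent_top, ← toReal_enorm]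
  refine ENNReal.toReal_mono ?_ hp
  rw [← eLpNorm_exponent_top]
  exact Lp.eLpNorm_ne_top s

theorem coeFn_jetInf (m : ℕ) (φ : D.smoothSpace) (α : MultiIndex m) :
    D.jetInf m φ α =ᵐ[D.μ] spatialDeriv α.exps φ :=
  MemLp.coeFn_toLp (IsCkBar.memLp φ.2 ∞ le_top)

/-- Pointwise Leibniz estimate: almost everywhere, each derivative of `φ` of order at most `m` is
bounded by the norm of its jet, and each derivative of `ψ` by the sum over all multi-indices. -/
theorem ae_abs_jet2_mulTest_le (m : ℕ) (φ : D.smoothSpace) (ψ : D.testSpace) (α : MultiIndex m) :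
    ∀ᵐ p ∂D.μ, |D.jet2 m (mulTest φ ψ) α p| ≤
      2 ^ m * (‖D.jetInf m φ‖ * ∑ β, |D.jet2 m ψ β p|) := by
  obtain ⟨⟨f, hf, hfe⟩, -⟩ := ψ.2 (m + 1) (by omega)
  obtain ⟨g, hg', hge⟩ := φ.2
  have hg : IsCk0 ((m + 1 : ℕ) : ℕ∞) g := hg'.of_le le_top
  have hprod : EqOn ((mulTest φ ψ : D.testSpace) : Pt → ℝ) (g * f) D.Ω := fun p hp => by
    simp [mulTest, hfe hp, hge hp]
  have h1 : ∀ᵐ p ∂D.μ, ∀ β : MultiIndex m, D.jet2 m ψ β p = spatialDeriv β.exps ψ p :=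
    ae_all_iff.mpr fun β => coeFn_jet2 m ψ β
  have h2 : ∀ᵐ p ∂D.μ, ∀ β : MultiIndex m, D.jetInf m φ β p = spatialDeriv β.exps φ p :=
    ae_all_iff.mpr fun β => coeFn_jetInf m φ β
  have h3 : ∀ᵐ p ∂D.μ, ∀ β : MultiIndex m, ‖D.jetInf m φ β p‖ ≤ ‖D.jetInf m φ β‖ :=
    ae_all_iff.mpr fun β => ae_norm_le_norm _
  filter_upwards [coeFn_jet2 m (mulTest φ ψ) α, h1, h2, h3, ae_restrict_mem measurableSet_Ω]
    with p e0 e1 e2 e3 hp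
  have hα : ∑ i, α.exps i ≤ m := α.2
  have hl := length_sortedList α.exps
  have hgl : IsXCk (sortedList α.exps).length g := hg.isXCk.of_le (by omega)
  have hfl : IsXCk (sortedList α.exps).length f := hf.isXCk.of_le (by omega)
  rw [e0, spatialDeriv_congr hprod _ hp,
    spatialDeriv_eq_xPartials_sortedList (by rw [← hl]; exact (hgl.mul hfl).sliceContDiff)]
  have hM : ∀ K : List (Fin 3), K.length ≤ (sortedList α.exps).length →
      |xPartials K g p| ≤ ‖D.jetInf m φ‖ := by
    intro K hK
    obtain ⟨β, hβ⟩ := MultiIndex.exists_exps_eq_count (m := m) (J := K) (by omega)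
    rw [← spatialDeriv_eq_xPartials hβ (hgl.sliceContDiff.of_le hK),
      ← spatialDeriv_congr hge _ hp, ← e2]
    exact (e3 β).trans (norm_le_pi_norm _ β)
  have hN : ∀ K : List (Fin 3), K.length ≤ (sortedList α.exps).length →
      |xPartials K f p| ≤ ∑ β, |D.jet2 m ψ β p| := by
    intro K hK
    obtain ⟨β, hβ⟩ := MultiIndex.exists_exps_eq_count (m := m) (J := K) (by omega)
    rw [← spatialDeriv_eq_xPartials hβ (hfl.sliceContDiff.of_le hK),
      ← spatialDeriv_congr hfe _ hp, ← e1]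
    exact Finset.single_le_sum (f := fun β => |D.jet2 m ψ β p|) (fun _ _ => abs_nonneg _)
      (Finset.mem_univ β)
  refine (abs_xPartials_mul_le hgl hfl hM hN).trans ?_
  refine mul_le_mul_of_nonneg_right (pow_le_pow_right₀ one_le_two (by omega)) ?_
  exact mul_nonneg (norm_nonneg _) (Finset.sum_nonneg fun _ _ => abs_nonneg _)

/-- The constant in the product estimate. -/
noncomputable def productConst (m : ℕ) : ℝ :=
  Fintype.card (MultiIndex m) * (2 ^ m * Fintype.card (MultiIndex m))

theorem productConst_pos (m : ℕ) : 0 < productConst m := by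
  have : Nonempty (MultiIndex m) := ⟨MultiIndex.zero m⟩
  have h : (0 : ℝ) < Fintype.card (MultiIndex m) := by exact_mod_cast Fintype.card_pos
  unfold productConst
  positivity

/-- In `productConst`, one factor `N`, the number of multi-indices, comes from the sum over `β` in
the Leibniz estimate. The other comes from summing over the components `α`, where `N * T ^ 2 ≤ (N *
T) ^ 2` is used instead of a square root. -/
theorem norm_toH0_mulTest_le (m : ℕ) (φ : D.smoothSpace) (ψ : D.testSpace) :
    ‖D.toH0 m (mulTest φ ψ)‖ ≤ productConst m * ‖D.jetInf m φ‖ * ‖D.toH0 m ψ‖ := by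
  change ‖D.jet2 m (mulTest φ ψ)‖ ≤ productConst m * ‖D.jetInf m φ‖ * ‖D.jet2 m ψ‖
  set N : ℝ := (Fintype.card (MultiIndex m) : ℝ) with hN
  have hN1 : 1 ≤ N := by
    have : Nonempty (MultiIndex m) := ⟨MultiIndex.zero m⟩
    rw [hN, Nat.one_le_cast]
    exact Fintype.card_pos
  set T : ℝ := 2 ^ m * ‖D.jetInf m φ‖ * (N * ‖D.jet2 m ψ‖) with hT
  have hT0 : 0 ≤ T := by positivity
  have hcomp : ∀ α, ‖D.jet2 m (mulTest φ ψ) α‖ ≤ T := by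
    intro α
    have h1 : ‖D.jet2 m (mulTest φ ψ) α‖ ≤
        2 ^ m * ‖D.jetInf m φ‖ * ‖∑ β, |D.jet2 m ψ β|‖ := by
      refine Lp.norm_le_mul_norm_of_ae_le_mul ?_
      have habs : ∀ᵐ p ∂D.μ, ∀ β, (|D.jet2 m ψ β| : Lp ℝ 2 D.μ) p = |D.jet2 m ψ β p| :=
        ae_all_iff.mpr fun β => Lp.coeFn_abs _
      filter_upwards [ae_abs_jet2_mulTest_le m φ ψ α, habs,
        Lp.coeFn_fun_finsetSum Finset.univ fun β => |D.jet2 m ψ β|] with p h2 h3 h4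
      rw [h4, Real.norm_eq_abs, Real.norm_eq_abs]
      simp only [h3]
      rw [abs_of_nonneg (a := ∑ β, |D.jet2 m ψ β p|)
        (Finset.sum_nonneg fun _ _ => abs_nonneg _), mul_assoc]
      exact h2
    refine h1.trans (mul_le_mul_of_nonneg_left ?_ (by positivity))
    calc ‖∑ β, |D.jet2 m ψ β|‖ ≤ ∑ β, ‖|D.jet2 m ψ β|‖ := norm_sum_le _ _
      _ ≤ ∑ _β : MultiIndex m, ‖D.jet2 m ψ‖ := Finset.sum_le_sum fun β _ => by
        rw [norm_abs_eq_norm]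
        exact PiLp.norm_apply_le _ β
      _ = N * ‖D.jet2 m ψ‖ := by simp [hN]
  have hsq : ‖D.jet2 m (mulTest φ ψ)‖ ^ 2 ≤ (N * T) ^ 2 := by
    rw [PiLp.norm_sq_eq_of_L2]
    calc _ ≤ ∑ _α : MultiIndex m, T ^ 2 :=
          Finset.sum_le_sum fun α _ => pow_le_pow_left₀ (norm_nonneg _) (hcomp α) 2
      _ = N * T ^ 2 := by simp [hN]
      _ ≤ (N * T) ^ 2 := by
        rw [mul_pow N T]
        exact mul_le_mul_of_nonneg_right (le_self_pow₀ hN1 two_ne_zero) (sq_nonneg T)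
  refine (pow_le_pow_iff_left₀ (norm_nonneg _) (by positivity) two_ne_zero).mp hsq |>.trans_eq ?_
  rw [hT, productConst]
  ring

theorem mulTest_sub (φ φ' : D.smoothSpace) (ψ : D.testSpace) :
    mulTest (φ - φ') ψ = mulTest φ ψ - mulTest φ' ψ :=
  Subtype.ext (sub_mul (φ : Pt → ℝ) φ' ψ)

instance (m : ℕ) : CompleteSpace (D.H0 m) :=
  (Submodule.isClosed_topologicalClosure _).completeSpace_coe

theorem fn_toH0_ae (m : ℕ) (ψ : D.testSpace) : H0.fn (D.toH0 m ψ) =ᵐ[D.μ] (ψ : Pt → ℝ) := by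
  obtain ⟨⟨f, hf, hfe⟩, -⟩ := ψ.2 1 le_rfl
  refine (coeFn_jet2 m ψ (MultiIndex.zero m)).trans (ae_eq_of_eqOn fun p hp => ?_)
  rw [spatialDeriv_congr hfe _ hp, hfe hp]
  exact congrFun (spatialDeriv_zero (hf.sliceContDiff.of_le (Nat.zero_le _))) p

theorem fn_jetInf_ae (m : ℕ) (φ : D.smoothSpace) :
    D.jetInf m φ (MultiIndex.zero m) =ᵐ[D.μ] (φ : Pt → ℝ) := by
  obtain ⟨f, hf, hfe⟩ := φ.2
  refine (coeFn_jetInf m φ (MultiIndex.zero m)).trans (ae_eq_of_eqOn fun p hp => ?_)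
  have hf0 : IsCk0 ((0 : ℕ) : ℕ∞) f := hf.of_le le_top
  rw [spatialDeriv_congr hfe _ hp, hfe hp]
  exact congrFun (spatialDeriv_zero hf0.sliceContDiff) p

theorem continuous_H0_fn (m : ℕ) : Continuous (H0.fn : D.H0 m → Lp ℝ 2 D.μ) :=
  (PiLp.continuous_apply 2 _ _).comp continuous_subtype_val

theorem isProduct_unique {m : ℕ} {σ : D.W m} {ψ : D.testSpace} {w w' : D.H0 m}
    (h : IsProduct σ ψ w) (h' : IsProduct σ ψ w') : w = w' := by
  have he : H0.fn w = H0.fn w' := Lp.ext (h.trans h'.symm)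
  refine sub_eq_zero.mp (H0.fn_injective ?_)
  exact sub_eq_zero.mpr he

open Filter in
theorem exists_isProduct {m : ℕ} (σ : D.W m) (ψ : D.testSpace) :
    ∃ w : D.H0 m, IsProduct σ ψ w ∧ ‖w‖ ≤ productConst m * ‖σ‖ * ‖D.toH0 m ψ‖ := by
  obtain ⟨x, hx, hxσ⟩ := mem_closure_iff_seq_limit.mp
    (show (σ : D.JetInf m) ∈ closure (LinearMap.range (D.jetInf m) : Set (D.JetInf m)) from σ.2)
  choose φ hφ using hx
  set y : ℕ → D.H0 m := fun n => D.toH0 m (mulTest (φ n) ψ) with hy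
  have hK : ∀ n k, dist (y n) (y k) ≤ productConst m * dist (x n) (x k) * ‖D.toH0 m ψ‖ := by
    intro n k
    have := norm_toH0_mulTest_le m (φ n - φ k) ψ
    rwa [mulTest_sub, map_sub, map_sub, hφ, hφ, ← dist_eq_norm, ← dist_eq_norm] at this
  -- The product is linear in the smooth factor, so the estimate applied to `φ n - φ k` transfers
  -- the Cauchy property.
  have hcau : CauchySeq y := by
    have h1 := cauchySeq_iff_tendsto_dist_atTop_0.mp hxσ.cauchySeq
    refine cauchySeq_iff_tendsto_dist_atTop_0.mpr
      (squeeze_zero (fun _ => dist_nonneg) (fun n => hK n.1 n.2) ?_)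
    simpa using (h1.const_mul (productConst m)).mul_const ‖D.toH0 m ψ‖
  obtain ⟨w, hw⟩ := cauchySeq_tendsto_of_complete hcau
  refine ⟨w, ?_, ?_⟩
  · have hmem : MemLp (fun p => W.fn σ p * (H0.fn (D.toH0 m ψ)) p) 2 D.μ :=
      (Lp.memLp (H0.fn (D.toH0 m ψ))).mul' (Lp.memLp (W.fn σ))
    -- Uniform convergence of the coefficients yields `L²` convergence of the products, which
    -- identifies the function underlying the limit `w`.
    have hlim : Tendsto (fun n => H0.fn (y n)) atTop (nhds (hmem.toLp _)) := by
      rw [tendsto_iff_norm_sub_tendsto_zero]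
      have hx0 : Tendsto (fun n => ‖x n (MultiIndex.zero m) - W.fn σ‖) atTop (nhds 0) :=
        tendsto_iff_norm_sub_tendsto_zero.mp ((tendsto_pi_nhds.mp hxσ) (MultiIndex.zero m))
      refine squeeze_zero (fun _ => norm_nonneg _) (fun n => ?_)
        (by simpa using hx0.mul_const ‖H0.fn (D.toH0 m ψ)‖)
      refine Lp.norm_le_mul_norm_of_ae_le_mul ?_
      have h5 := fn_jetInf_ae m (φ n)
      rw [hφ] at h5
      filter_upwards [Lp.coeFn_sub (H0.fn (y n)) (hmem.toLp _), hmem.coeFn_toLp,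
        fn_toH0_ae m (mulTest (φ n) ψ), fn_toH0_ae m ψ, h5,
        ae_norm_le_norm (x n (MultiIndex.zero m) - W.fn σ),
        Lp.coeFn_sub (x n (MultiIndex.zero m)) (W.fn σ)] with p e1 e2 e3 e4 e5 e6 e7
      rw [e1, Pi.sub_apply, e2, e3]
      rw [e7, Pi.sub_apply, e5] at e6
      simp only [mulTest, Pi.mul_apply]
      rw [e4, ← sub_mul, norm_mul]
      exact mul_le_mul_of_nonneg_right e6 (norm_nonneg _)
    have he : H0.fn w = hmem.toLp _ :=
      tendsto_nhds_unique (((continuous_H0_fn m).tendsto w).comp hw) hlim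
    rw [IsProduct, he]
    filter_upwards [hmem.coeFn_toLp, fn_toH0_ae m ψ] with p e1 e2
    rw [e1, e2]
  · have h1 : Tendsto (fun n => ‖x n‖) atTop (nhds ‖σ‖) := hxσ.norm
    refine le_of_tendsto_of_tendsto' hw.norm
      ((h1.const_mul (productConst m)).mul_const ‖D.toH0 m ψ‖) fun n => ?_
    have := norm_toH0_mulTest_le m (φ n) ψ
    rwa [hφ] at this

theorem productBound_productConst (D : Domain) (m : ℕ) : D.ProductBound m (productConst m) := by
  intro σ ψ w hw
  obtain ⟨w', h1, h2⟩ := exists_isProduct σ ψ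
  rwa [isProduct_unique hw h1]

/-! ### The transport operator -/

theorem isTransportImage_add {m : ℕ} {σ : D.W m} {ψ : D.testSpace} {w : D.H0 m}
    (hw : IsProduct σ ψ w) : IsTransportImage σ ψ (D.toH0 m (streamingTest ψ) + w) := by
  have h1 : H0.fn (D.toH0 m (streamingTest ψ) + w) =
    H0.fn (D.toH0 m (streamingTest ψ)) + H0.fn w := rfl
  rw [IsTransportImage, h1]
  filter_upwards [Lp.coeFn_add (H0.fn (D.toH0 m (streamingTest ψ))) (H0.fn w), hw,
    fn_toH0_ae m (streamingTest ψ)] with p e1 e2 e3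
  rw [e1, Pi.add_apply, e2, e3]
  rfl

theorem isTransportImage_unique {m : ℕ} {σ : D.W m} {ψ : D.testSpace} {w w' : D.H0 m}
    (h : IsTransportImage σ ψ w) (h' : IsTransportImage σ ψ w') : w = w' := by
  have he : H0.fn w = H0.fn w' := Lp.ext (h.trans h'.symm)
  refine sub_eq_zero.mp (H0.fn_injective ?_)
  exact sub_eq_zero.mpr he

/-- Quasi-accretivity before taking closures: the streaming part contributes a nonnegative amount,
and Cauchy–Schwarz with the product bound controls the rest. -/
theorem inner_transportGraph_ge {m : ℕ} {σ : D.W m} {c : ℝ} (hc : D.ProductBound m c)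
    {z : D.H0 m × D.H0 m} (hz : z ∈ transportGraph σ) :
    -(c * ‖σ‖) * ‖z.1‖ ^ 2 ≤ inner ℝ z.2 z.1 := by
  obtain ⟨ψ, h1, h2⟩ := hz
  obtain ⟨w, hw, -⟩ := exists_isProduct σ ψ
  rw [isTransportImage_unique h2 (isTransportImage_add hw), ← h1, inner_add_left]
  have h3 := inner_streamingTest_nonneg m ψ
  have h4 := (abs_le.mp (abs_real_inner_le_norm w (D.toH0 m ψ))).1
  have h5 := mul_le_mul_of_nonneg_right (hc σ ψ w hw) (norm_nonneg (D.toH0 m ψ))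
  nlinarith

theorem denseRange_toH0 (m : ℕ) : DenseRange (D.toH0 m) := by
  intro u
  rw [closure_subtype]
  have h : (Subtype.val '' range (D.toH0 m) : Set (D.Jet2 m)) = LinearMap.range (D.jet2 m) := by
    ext v
    constructor
    · rintro ⟨_, ⟨ψ, rfl⟩, rfl⟩
      exact ⟨ψ, rfl⟩
    · rintro ⟨ψ, rfl⟩
      exact ⟨_, ⟨ψ, rfl⟩, rfl⟩
  rw [h]
  exact u.2

end Domain

/-! ### Quasi-accretive linear relations in a real inner product space -/

section Relation

variable {H : Type*} [NormedAddCommGroup H] [InnerProductSpace ℝ H]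

/-- Both sides are continuous in the pair `z`. -/
theorem inner_ge_of_mem_topologicalClosure {g : Submodule ℝ (H × H)} {κ : ℝ}
    (hg : ∀ z ∈ g, -κ * ‖z.1‖ ^ 2 ≤ inner ℝ z.2 z.1) {z : H × H}
    (hz : z ∈ g.topologicalClosure) : -κ * ‖z.1‖ ^ 2 ≤ inner ℝ z.2 z.1 := by
  have hcl : IsClosed {z : H × H | -κ * ‖z.1‖ ^ 2 ≤ inner ℝ z.2 z.1} :=
    isClosed_le (by fun_prop) (by fun_prop)
  exact closure_minimal (s := (g : Set (H × H))) (fun z h => hg z h) hcl hz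

/-- A quasi-accretive linear relation with dense domain is single-valued. -/
theorem snd_eq_zero_of_quasiaccretive {g : Submodule ℝ (H × H)} {κ : ℝ}
    (hg : ∀ z ∈ g, -κ * ‖z.1‖ ^ 2 ≤ inner ℝ z.2 z.1) (hd : Dense (Prod.fst '' (g : Set (H × H))))
    {z : H × H} (hz : z ∈ g) (h0 : z.1 = 0) : z.2 = 0 := by
  have horth : ∀ y ∈ Prod.fst '' (g : Set (H × H)), inner ℝ z.2 y = 0 := by
    rintro _ ⟨y, hy, rfl⟩
    -- The hypothesis at `z + t • y`, with `z.1 = 0`, is a quadratic in `t` without constant term.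
    -- Its nonnegativity forces the linear coefficient to vanish.
    have h1 : ∀ t : ℝ, 0 ≤ (inner ℝ y.2 y.1 + κ * ‖y.1‖ ^ 2) * (t * t) +
        inner ℝ z.2 y.1 * t + 0 := by
      intro t
      have := hg _ (g.add_mem hz (g.smul_mem t hy))
      simp only [Prod.fst_add, Prod.snd_add, Prod.smul_fst, Prod.smul_snd, h0, zero_add,
        inner_add_left, inner_smul_left, inner_smul_right, norm_smul, mul_pow,
        Real.norm_eq_abs, sq_abs, conj_trivial] at this
      nlinarith
    have h2 := discrim_le_zero h1
    rw [discrim, mul_zero, sub_zero] at h2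
    exact pow_eq_zero_iff two_ne_zero |>.mp (le_antisymm h2 (sq_nonneg _))
  exact hd.eq_zero_of_inner_left ℝ horth

/-- The closure of the graph inherits both the inequality and the dense domain, so it is
single-valued, that is, the graph of an operator. -/
theorem isClosable_of_quasiaccretive {A : H →ₗ.[ℝ] H} {κ : ℝ}
    (hA : ∀ z ∈ A.graph, -κ * ‖z.1‖ ^ 2 ≤ inner ℝ z.2 z.1)
    (hd : Dense (Prod.fst '' (A.graph : Set (H × H)))) : A.IsClosable := by
  refine ⟨A.graph.topologicalClosure.toLinearPMap, ?_⟩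
  rw [Submodule.toLinearPMap_graph_eq]
  exact fun z hz h0 => snd_eq_zero_of_quasiaccretive
    (fun _ hz => inner_ge_of_mem_topologicalClosure hA hz)
    (hd.mono (image_mono (Submodule.le_topologicalClosure _))) hz h0

theorem inner_closure_ge {A : H →ₗ.[ℝ] H} (hcl : A.IsClosable) {κ : ℝ}
    (hA : ∀ z ∈ A.graph, -κ * ‖z.1‖ ^ 2 ≤ inner ℝ z.2 z.1) (u : A.closure.domain) :
    -κ * ‖(u : H)‖ ^ 2 ≤ inner ℝ (A.closure u) (u : H) := by
  have hmem := A.closure.mem_graph u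
  rw [← hcl.graph_closure_eq_closure_graph] at hmem
  exact inner_ge_of_mem_topologicalClosure hA hmem

theorem inner_closure_add_smul_ge {A : H →ₗ.[ℝ] H} (hcl : A.IsClosable) {κ : ℝ}
    (hA : ∀ z ∈ A.graph, -κ * ‖z.1‖ ^ 2 ≤ inner ℝ z.2 z.1) (C : ℝ) (u : A.closure.domain) :
    (C - κ) * ‖(u : H)‖ ^ 2 ≤ inner ℝ (A.closure u + C • (u : H)) (u : H) := by
  have h := inner_closure_ge hcl hA u
  rw [inner_add_left, inner_smul_left, real_inner_self_eq_norm_sq, conj_trivial]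
  linarith

theorem isAccretive_smul_id_vadd_closure {A : H →ₗ.[ℝ] H} (hcl : A.IsClosable) {κ : ℝ}
    (hA : ∀ z ∈ A.graph, -κ * ‖z.1‖ ^ 2 ≤ inner ℝ z.2 z.1) {C : ℝ} (hC : κ ≤ C) :
    IsAccretive ((C • (LinearMap.id : H →ₗ[ℝ] H)) +ᵥ A.closure) := by
  intro u
  rw [LinearPMap.vadd_apply, add_comm]
  exact (mul_nonneg (sub_nonneg.mpr hC) (sq_nonneg _)).trans
    (inner_closure_add_smul_ge hcl hA C u)

end Relation

/-! ### Application of the abstract results to the transport operator -/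

namespace Domain

variable {D : Domain}

theorem mem_transportGraph {m : ℕ} {σ : D.W m} {ψ : D.testSpace} {w : D.H0 m}
    (hw : IsProduct σ ψ w) :
    (D.toH0 m ψ, D.toH0 m (streamingTest ψ) + w) ∈ transportGraph σ :=
  ⟨ψ, rfl, isTransportImage_add hw⟩

theorem dense_fst_transportGraph {m : ℕ} (σ : D.W m) :
    Dense (Prod.fst '' (transportGraph σ : Set (D.H0 m × D.H0 m))) := by
  refine (denseRange_toH0 m).mono ?_
  rintro _ ⟨ψ, rfl⟩
  obtain ⟨w, hw, -⟩ := exists_isProduct σ ψ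
  exact mem_image_of_mem Prod.fst (mem_transportGraph hw)

/-- `toLinearPMap` recovers a relation only if it is single-valued, and quasi-accretivity with dense
domain provides this. -/
theorem graph_transportOp {m : ℕ} (σ : D.W m) : (transportOp σ).graph = transportGraph σ :=
  Submodule.toLinearPMap_graph_eq _ fun _ hz h0 => snd_eq_zero_of_quasiaccretive
    (fun _ hz => inner_transportGraph_ge (productBound_productConst D m) hz)
    (dense_fst_transportGraph σ) hz h0

theorem inner_graph_transportOp_ge {m : ℕ} {σ : D.W m} {c : ℝ} (hc : D.ProductBound m c) :
    ∀ z ∈ (transportOp σ).graph, -(c * ‖σ‖) * ‖z.1‖ ^ 2 ≤ inner ℝ z.2 z.1 := by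
  rw [graph_transportOp]
  exact fun _ hz => inner_transportGraph_ge hc hz

theorem isClosable_transportOp {m : ℕ} (σ : D.W m) : (transportOp σ).IsClosable :=
  isClosable_of_quasiaccretive (inner_graph_transportOp_ge (productBound_productConst D m))
    (by rw [graph_transportOp]; exact dense_fst_transportGraph σ)

theorem toH0_mem_domain_transportOp {m : ℕ} (σ : D.W m) (ψ : D.testSpace) :
    ∃ h : D.toH0 m ψ ∈ (transportOp σ).domain,
      IsTransportImage σ ψ (transportOp σ ⟨D.toH0 m ψ, h⟩) := by
  obtain ⟨w, hw, -⟩ := exists_isProduct σ ψ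
  have hmem : (D.toH0 m ψ, D.toH0 m (streamingTest ψ) + w) ∈ (transportOp σ).graph := by
    rw [graph_transportOp]
    exact mem_transportGraph hw
  have hdom := LinearPMap.mem_domain_of_mem_graph hmem
  refine ⟨hdom, ?_⟩
  rw [(transportOp σ).mem_graph_snd_inj ((transportOp σ).mem_graph ⟨_, hdom⟩) hmem rfl]
  exact isTransportImage_add hw

theorem inner_closure_transportOp_ge {m : ℕ} {σ : D.W m} {c : ℝ} (hc : D.ProductBound m c)
    (C : ℝ) (u : (transportOp σ).closure.domain) :
    (C - c * ‖σ‖) * ‖(u : D.H0 m)‖ ^ 2 ≤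
      inner ℝ ((transportOp σ).closure u + C • (u : D.H0 m)) (u : D.H0 m) :=
  inner_closure_add_smul_ge (isClosable_transportOp σ) (inner_graph_transportOp_ge hc) C u

theorem isAccretive_closure_transportOp {m : ℕ} {σ : D.W m} {c : ℝ} (hc : D.ProductBound m c)
    {C : ℝ} (hC : c * ‖σ‖ ≤ C) :
    IsAccretive ((C • (LinearMap.id : D.H0 m →ₗ[ℝ] D.H0 m)) +ᵥ (transportOp σ).closure) :=
  isAccretive_smul_id_vadd_closure (isClosable_transportOp σ) (inner_graph_transportOp_ge hc) hC

end Domain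

end Transport

theorem lemma3p1 (m : ℕ) :
    -- a constant for the product estimate exists and depends on `m` only
    (∃ c : ℝ, 0 < c ∧ ∀ D : Transport.Domain, D.ProductBound m c) ∧
    ∀ (D : Transport.Domain) (σ : D.W m),
      -- the products `Σ ψ` and the operator `P_m` are well defined, and `P_m` is closable
      (∀ ψ : D.testSpace, ∃! w : D.H0 m, Transport.Domain.IsProduct σ ψ w) ∧
      (∀ ψ : D.testSpace, ∃ h : D.toH0 m ψ ∈ (Transport.Domain.transportOp σ).domain,
        Transport.Domain.IsTransportImage σ ψ
          (Transport.Domain.transportOp σ ⟨D.toH0 m ψ, h⟩)) ∧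
      (Transport.Domain.transportOp σ).IsClosable ∧
      -- the estimate, for every constant `c` that is admissible in the product estimate
      ∀ c : ℝ, 0 < c → D.ProductBound m c → ∀ C : ℝ, c * ‖σ‖ ≤ C →
        (∀ ψ : (Transport.Domain.transportOp σ).closure.domain,
          (C - c * ‖σ‖) * ‖(ψ : D.H0 m)‖ ^ 2 ≤
            inner ℝ ((Transport.Domain.transportOp σ).closure ψ + C • (ψ : D.H0 m))
              (ψ : D.H0 m)) ∧
        Transport.IsAccretive
          ((C • (LinearMap.id : D.H0 m →ₗ[ℝ] D.H0 m)) +ᵥ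
            (Transport.Domain.transportOp σ).closure) := by
  refine ⟨⟨Transport.Domain.productConst m, Transport.Domain.productConst_pos m,
    fun D => D.productBound_productConst m⟩, fun D σ => ⟨fun ψ => ?_,
    Transport.Domain.toH0_mem_domain_transportOp σ, Transport.Domain.isClosable_transportOp σ,
    fun c _ hc C hC => ⟨Transport.Domain.inner_closure_transportOp_ge hc C,
      Transport.Domain.isAccretive_closure_transportOp hc hC⟩⟩⟩
  obtain ⟨w, hw, -⟩ := Transport.Domain.exists_isProduct σ ψ
  exact ⟨w, hw, fun w' hw' => Transport.Domain.isProduct_unique hw' hw⟩
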